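/- All Hilbert spaces are finite-dimensional and nonzero, and $S(\rho)=-\operatorname{tr}[\rho\log_2\rho]$ is the von Neumann entropy. A quantum channel is a completely positive trace-preserving linear map. A channel $\Psi_0$ is classical if there are orthonormal bases $\{|e_x\rangle\}$ of its input space and $\{|f_y\rangle\}$ of its output space and transition probabilities $W(y|x)$ such that $\Psi_0(\rho)=\sum_{x,y}W(y|x)\,\langle e_x|\rho|e_x\rangle\,|f_y\rangle\langle f_y|$. For a channel $\Phi$, let $$\mathcal C^{(1)}(\Phi)=\max_{\{p_i,\rho_i\}} \Big[S\Big(\sum_i p_i\Phi(\rho_i)\Big)-\sum_i p_iS(\Phi(\rho_i))\Big],$$ where the maximum is over all finite ensembles of input states. Let $\mathcal C(\Phi)=\lim_{n\to\infty}\frac1n\,\mathcal C^{(1)}(\Phi^{\otimes n})$ be the classical capacity. For $P\ge 0$ let $$\mathcal C^{(1)}_P(\Phi)=\max_{\{p_i,\rho_i\}:\ \sum_ip_iS(\rho_i)\le P}\Big[\sum_ip_iS(\rho_i)+S\Big(\Phi\Big(\sum_ip_i\rho_i\Big)\Big)-\sum_ip_iS\big((\Phi\otimes\mathcal I)(\phi_i)\big)\Big]$$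 be the one-shot classical capacity with entanglement assistance $P$, where $\phi_i=|\phi_i\rangle\langle\phi_i|$ is a purification of $\rho_i$ and $\mathcal I$ is the identity channel on the purifying system. **Lemma.** Let $\Psi_0$ be a classical channel, $\Psi_1$ a quantum channel, and $P\ge0$. Then the maxima defining $\mathcal C^{(1)}(\Psi_0^{\otimes n})$ for all $n$, $\mathcal C^{(1)}_P(\Psi_1)$ and $\mathcal C^{(1)}_P(\Psi_0\otimes\Psi_1)$ are attained, the limit defining $\mathcal C(\Psi_0)$ exists, and $$\mathcal C^{(1)}_P(\Psi_0\otimes\Psi_1)=\mathcal C(\Psi_0)+\mathcal C^{(1)}_P(\Psi_1).$$ -/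

import Mathlib

open Filter Topology
open scoped Matrix Kronecker ComplexOrder

noncomputable section

namespace QShannon

/-- A density matrix on the finite-dimensional Hilbert space with computational basis `A`. -/
def IsState {A : Type*} [Fintype A] (ρ : Matrix A A ℂ) : Prop :=
  ρ.PosSemidef ∧ ρ.trace = 1

/-- The von Neumann entropy `S(ρ) = - tr (ρ log₂ ρ)`, in bits; `log₂` is applied to `ρ` by the
functional calculus (`0 log 0 = 0`). -/
def entropy {A : Type*} [Fintype A] [DecidableEq A] (ρ : Matrix A A ℂ) : ℝ :=
  -((ρ * cfc (Real.logb 2) ρ).trace).re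

/-- The tensor product `Φ ⊗ Ψ` of two linear maps between matrix spaces, i.e. the linear map
with `(Φ ⊗ Ψ)(X ⊗ Y) = Φ(X) ⊗ Ψ(Y)`, defined on matrix units and extended linearly. -/
def tensorMap {A B A' B' : Type*} [Fintype A] [DecidableEq A] [Fintype A'] [DecidableEq A']
    (Φ : Matrix A A ℂ →ₗ[ℂ] Matrix B B ℂ) (Ψ : Matrix A' A' ℂ →ₗ[ℂ] Matrix B' B' ℂ) :
    Matrix (A × A') (A × A') ℂ →ₗ[ℂ] Matrix (B × B') (B × B') ℂ where
  toFun X := ∑ i : A × A', ∑ j : A × A',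
    X i j • (Φ (Matrix.single i.1 j.1 1) ⊗ₖ Ψ (Matrix.single i.2 j.2 1))
  map_add' X Y := by
    simp only [Matrix.add_apply, add_smul, Finset.sum_add_distrib]
  map_smul' c X := by
    simp only [Matrix.smul_apply, smul_eq_mul, mul_smul, Finset.smul_sum, RingHom.id_apply]

/-- The `n`-fold tensor power `Φ^{⊗ n}`, acting on `A^{⊗ n}` with basis `Fin n → A`. -/
def tensorPow {A B : Type*} [Fintype A] [DecidableEq A]
    (Φ : Matrix A A ℂ →ₗ[ℂ] Matrix B B ℂ) (n : ℕ) :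
    Matrix (Fin n → A) (Fin n → A) ℂ →ₗ[ℂ] Matrix (Fin n → B) (Fin n → B) ℂ where
  toFun X := ∑ i : Fin n → A, ∑ j : Fin n → A,
    X i j • Matrix.of fun b b' : Fin n → B => ∏ t, Φ (Matrix.single (i t) (j t) 1) (b t) (b' t)
  map_add' X Y := by
    simp only [Matrix.add_apply, add_smul, Finset.sum_add_distrib]
  map_smul' c X := by
    simp only [Matrix.smul_apply, smul_eq_mul, mul_smul, Finset.smul_sum, RingHom.id_apply]

/-- The defining property of the tensor product of maps. -/
theorem tensorMap_kronecker {A B A' B' : Type*} [Fintype A] [DecidableEq A] [Fintype A']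
    [DecidableEq A'] (Φ : Matrix A A ℂ →ₗ[ℂ] Matrix B B ℂ)
    (Ψ : Matrix A' A' ℂ →ₗ[ℂ] Matrix B' B' ℂ) (X : Matrix A A ℂ) (Y : Matrix A' A' ℂ) :
    tensorMap Φ Ψ (X ⊗ₖ Y) = Φ X ⊗ₖ Ψ Y := by
  have hX : Φ X = ∑ i, ∑ j, X i j • Φ (Matrix.single i j 1) := by
    conv_lhs => rw [Matrix.matrix_eq_sum_single X]
    simp only [map_sum]
    refine Finset.sum_congr rfl fun i _ => Finset.sum_congr rfl fun j _ => ?_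
    rw [← map_smul, Matrix.smul_single, smul_eq_mul, mul_one]
  have hY : Ψ Y = ∑ i, ∑ j, Y i j • Ψ (Matrix.single i j 1) := by
    conv_lhs => rw [Matrix.matrix_eq_sum_single Y]
    simp only [map_sum]
    refine Finset.sum_congr rfl fun i _ => Finset.sum_congr rfl fun j _ => ?_
    rw [← map_smul, Matrix.smul_single, smul_eq_mul, mul_one]
  have hT : tensorMap Φ Ψ (X ⊗ₖ Y) = ∑ i, ∑ k, ∑ j, ∑ l, (X i j * Y k l) •
      (Φ (Matrix.single i j 1) ⊗ₖ Ψ (Matrix.single k l 1)) := by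
    simp only [tensorMap, LinearMap.coe_mk, AddHom.coe_mk, Matrix.kroneckerMap_apply,
      Fintype.sum_prod_type]
  rw [hT, hX, hY]
  ext ⟨b, c⟩ ⟨b', c'⟩
  simp only [Matrix.kroneckerMap_apply, Matrix.sum_apply, Matrix.smul_apply, smul_eq_mul,
    Finset.sum_mul_sum]
  refine Finset.sum_congr rfl fun i _ => Finset.sum_congr rfl fun k _ =>
    Finset.sum_congr rfl fun j _ => Finset.sum_congr rfl fun l _ => by ring

/-- A quantum channel: a completely positive trace preserving linear map. -/
def IsChannel {A B : Type*} [Fintype A] [DecidableEq A] [Fintype B]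
    (Φ : Matrix A A ℂ →ₗ[ℂ] Matrix B B ℂ) : Prop :=
  (∀ (k : ℕ) (X : Matrix (A × Fin k) (A × Fin k) ℂ), X.PosSemidef →
    (tensorMap Φ (LinearMap.id : Matrix (Fin k) (Fin k) ℂ →ₗ[ℂ] _) X).PosSemidef) ∧
  ∀ X : Matrix A A ℂ, (Φ X).trace = X.trace

/-- A classical channel: for some orthonormal bases `e` of the input space and `f` of the output
space and some transition probabilities `W x y = W(y|x)`,
`Φ(X) = ∑_{x,y} W(y|x) ⟨e_x|X|e_x⟩ |f_y⟩⟨f_y|`. -/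
def IsClassicalChannel {A B : Type*} [Fintype A] [Fintype B]
    (Φ : Matrix A A ℂ →ₗ[ℂ] Matrix B B ℂ) : Prop :=
  ∃ (e : OrthonormalBasis A ℂ (EuclideanSpace ℂ A))
    (f : OrthonormalBasis B ℂ (EuclideanSpace ℂ B)) (W : A → B → ℝ),
    (∀ x y, 0 ≤ W x y) ∧ (∀ x, ∑ y, W x y = 1) ∧
    ∀ X : Matrix A A ℂ, Φ X = ∑ x, ∑ y,
      ((W x y : ℂ) * (star (e x).ofLp ⬝ᵥ X *ᵥ (e x).ofLp)) •
        Matrix.vecMulVec (f y).ofLp (star (f y).ofLp)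

/-- A finite ensemble `{p_i, ρ_i}` of states. -/
def IsEnsemble {A : Type*} [Fintype A] {m : ℕ} (p : Fin m → ℝ) (ρ : Fin m → Matrix A A ℂ) :
    Prop :=
  (∀ i, 0 ≤ p i) ∧ ∑ i, p i = 1 ∧ ∀ i, IsState (ρ i)

/-- The density matrix `|φ⟩⟨φ|` of a vector `φ`. -/
def pureState {A : Type*} (φ : A → ℂ) : Matrix A A ℂ :=
  Matrix.vecMulVec φ (star φ)

/-- The vector `φ` in `H_A ⊗ H_E` is a purification of `ρ`, i.e. `tr_E |φ⟩⟨φ| = ρ`. -/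
def IsPurification {A E : Type*} [Fintype E] (φ : A × E → ℂ) (ρ : Matrix A A ℂ) : Prop :=
  ∀ a a', ∑ e, pureState φ (a, e) (a', e) = ρ a a'

/-- The Holevo informations `S(∑ p_i Φ(ρ_i)) - ∑ p_i S(Φ(ρ_i))` of all ensembles. -/
def holevoRates {A B : Type*} [Fintype A] [Fintype B] [DecidableEq B]
    (Φ : Matrix A A ℂ →ₗ[ℂ] Matrix B B ℂ) : Set ℝ :=
  {r | ∃ (m : ℕ) (p : Fin m → ℝ) (ρ : Fin m → Matrix A A ℂ), IsEnsemble p ρ ∧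
    r = entropy (∑ i, (p i : ℂ) • Φ (ρ i)) - ∑ i, p i * entropy (Φ (ρ i))}

/-- The 1-shot classical capacity (Holevo capacity) `C^{(1)}(Φ)`. -/
def oneShotCapacity {A B : Type*} [Fintype A] [Fintype B] [DecidableEq B]
    (Φ : Matrix A A ℂ →ₗ[ℂ] Matrix B B ℂ) : ℝ :=
  sSup (holevoRates Φ)

/-- The `n`-shot classical capacity `C^{(n)}(Φ) = C^{(1)}(Φ^{⊗ n}) / n`. -/
def nShotCapacity {A B : Type*} [Fintype A] [DecidableEq A] [Fintype B] [DecidableEq B]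
    (Φ : Matrix A A ℂ →ₗ[ℂ] Matrix B B ℂ) (n : ℕ) : ℝ :=
  oneShotCapacity (tensorPow Φ n) / n

/-- The (regularized) classical capacity `C(Φ) = lim_{n → ∞} C^{(n)}(Φ)`. -/
def capacity {A B : Type*} [Fintype A] [DecidableEq A] [Fintype B] [DecidableEq B]
    (Φ : Matrix A A ℂ →ₗ[ℂ] Matrix B B ℂ) : ℝ :=
  limUnder atTop (nShotCapacity Φ)

/-- The values `∑ p_i S(ρ_i) + S(Φ(∑ p_i ρ_i)) - ∑ p_i S((Φ ⊗ I_E)(φ_i))` over all ensembles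
`{p_i, ρ_i}` with `∑ p_i S(ρ_i) ≤ P`, where `φ_i` purifies `ρ_i`. -/
def assistedRates {A B : Type*} [Fintype A] [DecidableEq A] [Fintype B] [DecidableEq B]
    (Φ : Matrix A A ℂ →ₗ[ℂ] Matrix B B ℂ) (P : ℝ) : Set ℝ :=
  {r | ∃ (m : ℕ) (p : Fin m → ℝ) (ρ : Fin m → Matrix A A ℂ) (d : ℕ)
      (φ : Fin m → A × Fin d → ℂ),
    IsEnsemble p ρ ∧ (∀ i, IsPurification (φ i) (ρ i)) ∧ ∑ i, p i * entropy (ρ i) ≤ P ∧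
    r = ∑ i, p i * entropy (ρ i) + entropy (Φ (∑ i, (p i : ℂ) • ρ i)) -
      ∑ i, p i * entropy
        (tensorMap Φ (LinearMap.id : Matrix (Fin d) (Fin d) ℂ →ₗ[ℂ] _) (pureState (φ i)))}

/-- The 1-shot classical capacity with entanglement assistance `P`, `C^{(1)}_P(Φ)`. -/
def assistedOneShotCapacity {A B : Type*} [Fintype A] [DecidableEq A] [Fintype B]
    [DecidableEq B] (Φ : Matrix A A ℂ →ₗ[ℂ] Matrix B B ℂ) (P : ℝ) : ℝ :=
  sSup (assistedRates Φ P)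

end QShannon

end

/-! A classical channel measures its input in the basis `e` and then applies the transition matrix
`W`, so its Holevo information depends on the inputs only through their outcome distributions. Basis
states are therefore optimal inputs. Mutual information is at most additive over independent uses,
with equality for product inputs, so `C(Ψ₀)` is Shannon's capacity, the maximum of `classicalRate
W`.

Achievability (`add_mem_assistedRates`): tensor an ensemble for `Ψ₁` with basis states drawn from an
optimal distribution `q`. The basis states are pure, so they use no entanglement, and they add
`classicalRate W q` to the rate.

Converse (`le_of_mem_assistedRates`): take inputs `ρ_i` of the product channel, purified by a system
`E`, and measure the classical input. Outcome `x`, of probability `w_i(x)`, leaves a state `τ_{i,x}`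
on the input of `Ψ₁`, still purified by `E`. (1) The measurement does not change the average state
of `E`, so concavity of the entropy gives `∑_x w_i(x) S(τ_{i,x}) ≤ S(ρ_i)`. Hence the ensemble `{p_i
w_i(x), τ_{i,x}}` is admissible for `Ψ₁`. (2) The joint output with `E` is a sum of products over
`x`. Strong subadditivity then bounds the input entropy minus the entropy exchange by the average of
the corresponding quantity for `τ_{i,x}`, less the conditional entropy `∑_x w_i(x) H(W_x)`. (3)
Subadditivity splits the entropy of the average output. Adding up, the rate is at most a mutual
information of `W` plus an assisted rate of `Ψ₁`.

Both entropy inequalities come from the relative entropy: subadditivity from Klein's inequality,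
strong subadditivity from joint subadditivity. The latter holds because the relative entropy is, up
to a trace term, a limit of integrals of suprema of functionals linear in `(ρ, σ)`. The maxima are
attained because, once purifications are eliminated through the complementary channel, constraint
and objective depend on an ensemble only through a barycentre in a compact convex hull. -/

noncomputable section

namespace QShannon

/-- The function `x ↦ - x log₂ x`. -/
def eta (x : ℝ) : ℝ := Real.negMulLog x / Real.log 2

@[simp] theorem eta_zero : eta 0 = 0 := by simp [eta]

@[simp] theorem eta_one : eta 1 = 0 := by simp [eta]

theorem eta_mul (x y : ℝ) : eta (x * y) = y * eta x + x * eta y := by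
  simp only [eta, Real.negMulLog_mul]; ring

theorem continuous_eta : Continuous eta := Real.continuous_negMulLog.div_const _

theorem eta_eq_neg_mul_logb (x : ℝ) : eta x = -(x * Real.logb 2 x) := by
  simp only [eta, Real.negMulLog, Real.logb]; ring

set_option linter.unusedSectionVars false

/-! ### Von Neumann entropy through the spectrum -/

section Spectral

variable {A E : Type*} [Fintype A] [DecidableEq A] [Fintype E] [DecidableEq E]

theorem entropy_eq_re_trace_cfc (ρ : Matrix A A ℂ) :
    entropy ρ = (cfc eta ρ).trace.re := by
  by_cases hρ : IsSelfAdjoint ρ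
  -- The spectrum is finite, so the discontinuity of the logarithm at 0 does not matter to the
  -- functional calculus.
  · have hfin : ∀ f : ℝ → ℝ, ContinuousOn f (spectrum ℝ ρ) := fun f =>
      (Matrix.finite_real_spectrum (A := ρ)).continuousOn f
    have h : ρ * cfc (Real.logb 2) ρ = cfc (fun x => x * Real.logb 2 x) ρ := by
      rw [cfc_mul (fun x => x) (Real.logb 2) ρ (hfin _) (hfin _), cfc_id' ℝ ρ]
    have h' : cfc eta ρ = -cfc (fun x => x * Real.logb 2 x) ρ := by
      rw [← cfc_neg]
      exact cfc_congr fun x _ => eta_eq_neg_mul_logb x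
    rw [entropy, h, h', Matrix.trace_neg, Complex.neg_re]
  -- Off the self-adjoint matrices both functional calculi take the default value 0.
  · rw [entropy, cfc_apply_of_not_predicate _ hρ, cfc_apply_of_not_predicate _ hρ]
    simp

theorem entropy_eq_sum_eigenvalues {ρ : Matrix A A ℂ} (hρ : ρ.IsHermitian) :
    entropy ρ = ∑ i, eta (hρ.eigenvalues i) := by
  rw [entropy_eq_re_trace_cfc, hρ.cfc_eq, Matrix.IsHermitian.cfc,
    Unitary.conjStarAlgAut_apply, Matrix.trace_mul_cycle]
  simp [Matrix.trace_diagonal]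

/-- The entropy is determined by the multiset of roots of the characteristic polynomial. -/
theorem entropy_eq_roots {ρ : Matrix A A ℂ} (hρ : ρ.IsHermitian) :
    entropy ρ = (ρ.charpoly.roots.map fun z => eta z.re).sum := by
  rw [entropy_eq_sum_eigenvalues hρ, hρ.roots_charpoly_eq_eigenvalues, Multiset.map_map]
  simp

theorem isHermitian_conj_diagonal (U : Matrix A E ℂ) (d : E → ℝ) :
    (U * Matrix.diagonal (fun i => (d i : ℂ)) * Uᴴ).IsHermitian := by
  refine Matrix.isHermitian_mul_mul_conjTranspose U ?_
  exact Matrix.isHermitian_diagonal_of_self_adjoint _ (by ext; simp)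

/-- Passing through the roots of the characteristic polynomial avoids matching `d` with the ordering
of the eigenvalues chosen by the spectral theorem. -/
theorem entropy_conj_diagonal {U : Matrix A A ℂ} (hU : Uᴴ * U = 1) (d : A → ℝ) :
    entropy (U * Matrix.diagonal (fun i => (d i : ℂ)) * Uᴴ) = ∑ i, eta (d i) := by
  rw [entropy_eq_roots (isHermitian_conj_diagonal U d), Matrix.charpoly_mul_comm, ← mul_assoc, hU,
    one_mul, Matrix.charpoly_diagonal, Polynomial.roots_prod _ _
      (by simp [Finset.prod_ne_zero_iff, Polynomial.X_sub_C_ne_zero])]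
  simp

/-- Spectral decomposition with real eigenvalues. -/
theorem exists_conj_diagonal {ρ : Matrix A A ℂ} (hρ : ρ.IsHermitian) :
    ∃ (U : Matrix A A ℂ) (d : A → ℝ), Uᴴ * U = 1 ∧ U * Uᴴ = 1 ∧
      ρ = U * Matrix.diagonal (fun i => (d i : ℂ)) * Uᴴ ∧
      (ρ.PosSemidef → ∀ i, 0 ≤ d i) ∧ (ρ.PosDef → ∀ i, 0 < d i) := by
  refine ⟨hρ.eigenvectorUnitary, hρ.eigenvalues, ?_, ?_, ?_, fun h => h.eigenvalues_nonneg,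
    fun h => h.eigenvalues_pos⟩
  · exact Unitary.coe_star_mul_self _
  · exact Unitary.coe_mul_star_self _
  · have := hρ.spectral_theorem
    rw [Unitary.conjStarAlgAut_apply] at this
    exact this

theorem entropy_reindex (e : A ≃ E) (ρ : Matrix A A ℂ) (hρ : ρ.IsHermitian) :
    entropy (ρ.submatrix e.symm e.symm) = entropy ρ := by
  rw [entropy_eq_roots hρ, entropy_eq_roots (hρ.submatrix _), ← Matrix.reindex_apply,
    Matrix.charpoly_reindex]

theorem entropy_transpose {ρ : Matrix A A ℂ} (hρ : ρ.IsHermitian) : entropy ρᵀ = entropy ρ := by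
  rw [entropy_eq_roots hρ, entropy_eq_roots hρ.transpose, Matrix.charpoly_transpose]

/-- The two characteristic polynomials agree up to powers of `X`, and the extra zero roots
contribute `eta 0 = 0`. Every equality of entropies of complementary marginals of a pure state rests
on this. -/
theorem entropy_mul_conjTranspose_comm (M : Matrix A E ℂ) :
    entropy (M * Mᴴ) = entropy (Mᴴ * M) := by
  rw [entropy_eq_roots (Matrix.isHermitian_mul_conjTranspose_self M),
    entropy_eq_roots (Matrix.isHermitian_conjTranspose_mul_self M)]
  have h := congrArg (fun p : Polynomial ℂ => (p.roots.map fun z => eta z.re).sum)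
    (Matrix.charpoly_mul_comm' M Mᴴ)
  have hX : ∀ (k : ℕ) {p : Polynomial ℂ}, p.Monic →
      (((Polynomial.X ^ k * p).roots).map fun z : ℂ => eta z.re).sum =
        (p.roots.map fun z => eta z.re).sum := by
    intro k p hp
    rw [Polynomial.roots_mul (mul_ne_zero (pow_ne_zero _ Polynomial.X_ne_zero) hp.ne_zero)]
    simp [Multiset.map_nsmul, Multiset.sum_nsmul]
  simpa only [hX _ (Matrix.charpoly_monic _)] using h

/-- Conditional states are kept unnormalized below; this is the correction that their normalization
costs. -/
theorem entropy_smul {ρ : Matrix A A ℂ} (hρ : ρ.IsHermitian) (c : ℝ) :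
    entropy ((c : ℂ) • ρ) = c * entropy ρ + eta c * ρ.trace.re := by
  obtain ⟨U, d, hU, -, h, -⟩ := exists_conj_diagonal hρ
  have h1 : (c : ℂ) • ρ = U * Matrix.diagonal (fun i => ((c * d i : ℝ) : ℂ)) * Uᴴ := by
    rw [h, ← Matrix.smul_mul, ← Matrix.mul_smul, ← Matrix.diagonal_smul]
    congr 3; ext; simp
  have h2 : ρ.trace.re = ∑ i, d i := by
    rw [h, Matrix.trace_mul_cycle, hU, one_mul, Matrix.trace_diagonal]; simp
  rw [h1, entropy_conj_diagonal hU, h2, h, entropy_conj_diagonal hU, Finset.mul_sum,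
    Finset.mul_sum, ← Finset.sum_add_distrib]
  refine Finset.sum_congr rfl fun i _ => ?_
  rw [eta_mul]; ring

theorem kronecker_conj_diagonal {B F : Type*} [Fintype F] [DecidableEq F] (U : Matrix A E ℂ)
    (V : Matrix B F ℂ)
    (d : E → ℝ) (d' : F → ℝ) :
    (U * Matrix.diagonal (fun i => (d i : ℂ)) * Uᴴ) ⊗ₖ
        (V * Matrix.diagonal (fun i => (d' i : ℂ)) * Vᴴ) =
      (U ⊗ₖ V) * Matrix.diagonal (fun i : E × F => ((d i.1 * d' i.2 : ℝ) : ℂ)) * (U ⊗ₖ V)ᴴ := by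
  rw [Matrix.mul_kronecker_mul, Matrix.mul_kronecker_mul, Matrix.diagonal_kronecker_diagonal,
    Matrix.conjTranspose_kronecker]
  simp

theorem entropy_kronecker {ρ : Matrix A A ℂ} {σ : Matrix E E ℂ} (hρ : ρ.IsHermitian)
    (hσ : σ.IsHermitian) :
    entropy (ρ ⊗ₖ σ) = σ.trace.re * entropy ρ + ρ.trace.re * entropy σ := by
  obtain ⟨U, d, hU, -, h, -⟩ := exists_conj_diagonal hρ
  obtain ⟨V, d', hV, -, h', -⟩ := exists_conj_diagonal hσ
  have hUV : (U ⊗ₖ V)ᴴ * (U ⊗ₖ V) = 1 := by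
    rw [Matrix.conjTranspose_kronecker, ← Matrix.mul_kronecker_mul, hU, hV,
      Matrix.one_kronecker_one]
  have h2 : ρ.trace.re = ∑ i, d i := by
    rw [h, Matrix.trace_mul_cycle, hU, one_mul, Matrix.trace_diagonal]; simp
  have h3 : σ.trace.re = ∑ i, d' i := by
    rw [h', Matrix.trace_mul_cycle, hV, one_mul, Matrix.trace_diagonal]; simp
  rw [h2, h3, h, h', kronecker_conj_diagonal, entropy_conj_diagonal hU, entropy_conj_diagonal hV,
    entropy_conj_diagonal hUV, Fintype.sum_prod_type, Finset.sum_mul_sum, Finset.sum_mul_sum]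
  simp only [eta_mul, Finset.sum_add_distrib]
  rw [Finset.sum_comm]

open scoped Matrix.Norms.L2Operator in
-- The function `eta`, unlike the logarithm, is continuous at 0, so the functional calculus is
-- continuous even at singular matrices. This permits the later passage from positive definite to
-- positive semidefinite matrices.
theorem continuousOn_entropy :
    ContinuousOn (entropy : Matrix A A ℂ → ℝ) {ρ | ρ.IsHermitian} := by
  have h : ContinuousOn (fun ρ : Matrix A A ℂ => cfc eta ρ) {ρ | ρ.IsHermitian} :=
    ContinuousOn.cfc_of_mem_nhdsSet (s := Set.univ) eta Filter.univ_mem continuousOn_id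
      (fun _ h => h) continuous_eta.continuousOn
  have h2 : Continuous fun M : Matrix A A ℂ => M.trace.re :=
    Complex.continuous_re.comp (continuous_id.matrix_trace)
  exact (h2.comp_continuousOn h).congr fun ρ _ => entropy_eq_re_trace_cfc ρ

end Spectral

/-! ### Relative entropy: Klein's inequality and joint subadditivity -/

section RelativeEntropy

variable {A E : Type*} [Fintype A] [DecidableEq A] [Fintype E] [DecidableEq E]

/-- A diagonalization `ρ = U diag(d) U*` with `U` unitary and `d` real. -/
structure Diagonalization (ρ : Matrix A A ℂ) where
  U : Matrix A A ℂ
  d : A → ℝ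
  star_mul : Uᴴ * U = 1
  mul_star : U * Uᴴ = 1
  eq : ρ = U * Matrix.diagonal (fun i => (d i : ℂ)) * Uᴴ

theorem Diagonalization.trace_re {ρ : Matrix A A ℂ} (a : Diagonalization ρ) :
    ρ.trace.re = ∑ i, a.d i := by
  conv_lhs => rw [a.eq, Matrix.trace_mul_cycle, a.star_mul, one_mul, Matrix.trace_diagonal]
  simp

theorem Diagonalization.entropy_eq {ρ : Matrix A A ℂ} (a : Diagonalization ρ) :
    entropy ρ = ∑ i, eta (a.d i) := by
  conv_lhs => rw [a.eq]
  exact entropy_conj_diagonal a.star_mul _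

theorem exists_diagonalization_posDef {ρ : Matrix A A ℂ} (hρ : ρ.PosDef) :
    ∃ a : Diagonalization ρ, ∀ i, 0 < a.d i := by
  obtain ⟨U, d, h1, h2, h3, -, h4⟩ := exists_conj_diagonal hρ.isHermitian
  exact ⟨⟨U, d, h1, h2, h3⟩, h4 hρ⟩

/-- The tensor product of two diagonalizations. -/
def Diagonalization.kronecker {ρ : Matrix A A ℂ} {σ : Matrix E E ℂ} (a : Diagonalization ρ)
    (b : Diagonalization σ) : Diagonalization (ρ ⊗ₖ σ) where
  U := a.U ⊗ₖ b.U
  d := fun i => a.d i.1 * b.d i.2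
  star_mul := by
    rw [Matrix.conjTranspose_kronecker, ← Matrix.mul_kronecker_mul, a.star_mul, b.star_mul,
      Matrix.one_kronecker_one]
  mul_star := by
    rw [Matrix.conjTranspose_kronecker, ← Matrix.mul_kronecker_mul, a.mul_star, b.mul_star,
      Matrix.one_kronecker_one]
  eq := by
    conv_lhs => rw [a.eq, b.eq]
    exact kronecker_conj_diagonal _ _ _ _

/-- The trivial diagonalization of the identity. -/
def Diagonalization.one : Diagonalization (1 : Matrix A A ℂ) where
  U := 1
  d := fun _ => 1
  star_mul := by simp
  mul_star := by simp
  eq := by simp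

variable {ρ σ : Matrix A A ℂ}

/-- The squared overlaps `|⟨v_j, u_k⟩|²` of two eigenbases. -/
def overlap (a : Diagonalization ρ) (b : Diagonalization σ) (j k : A) : ℝ :=
  Complex.normSq ((b.Uᴴ * a.U) j k)

theorem overlap_nonneg (a : Diagonalization ρ) (b : Diagonalization σ) (j k : A) :
    0 ≤ overlap a b j k := Complex.normSq_nonneg _

theorem sum_overlap_left (a : Diagonalization ρ) (b : Diagonalization σ) (k : A) :
    ∑ j, overlap a b j k = 1 := by
  have h : (b.Uᴴ * a.U)ᴴ * (b.Uᴴ * a.U) = 1 := by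
    rw [Matrix.conjTranspose_mul, Matrix.conjTranspose_conjTranspose, Matrix.mul_assoc,
      ← Matrix.mul_assoc b.U, b.mul_star, Matrix.one_mul, a.star_mul]
  have h2 := congrFun (congrFun h k) k
  rw [Matrix.mul_apply, Matrix.one_apply_eq] at h2
  have h3 := congrArg Complex.re h2
  rw [Complex.re_sum] at h3
  simpa [overlap, Matrix.conjTranspose_apply, Complex.normSq_apply] using h3

theorem sum_overlap_right (a : Diagonalization ρ) (b : Diagonalization σ) (j : A) :
    ∑ k, overlap a b j k = 1 := by
  rw [← sum_overlap_left b a j]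
  refine Finset.sum_congr rfl fun k _ => ?_
  have : (b.Uᴴ * a.U) j k = star ((a.Uᴴ * b.U) k j) := by
    rw [← Matrix.conjTranspose_apply, Matrix.conjTranspose_mul, Matrix.conjTranspose_conjTranspose]
  rw [overlap, overlap, this, Complex.star_def, Complex.normSq_conj]

/-- With `g` the logarithms of the eigenvalues of `σ` this is `tr ρ log σ`, the link between the
double sum over eigenbases and the trace form of the relative entropy. -/
theorem sum_overlap_mul (a : Diagonalization ρ) (b : Diagonalization σ) (g : A → ℝ) :
    ∑ j, ∑ k, overlap a b j k * (a.d k * g j) =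
      (ρ * (b.U * Matrix.diagonal (fun j => (g j : ℂ)) * b.Uᴴ)).trace.re := by
  have h : (ρ * (b.U * Matrix.diagonal (fun j => (g j : ℂ)) * b.Uᴴ)).trace =
      ((b.Uᴴ * a.U) * Matrix.diagonal (fun k => (a.d k : ℂ)) * (b.Uᴴ * a.U)ᴴ *
        Matrix.diagonal (fun j => (g j : ℂ))).trace := by
    conv_lhs => rw [a.eq]
    rw [Matrix.conjTranspose_mul, Matrix.conjTranspose_conjTranspose, ← Matrix.mul_assoc,
      Matrix.trace_mul_comm]
    simp only [Matrix.mul_assoc]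
  rw [h, Matrix.trace, Complex.re_sum]
  refine Finset.sum_congr rfl fun j _ => ?_
  rw [Matrix.diag_apply, Matrix.mul_diagonal, Matrix.mul_apply, Finset.sum_mul, Complex.re_sum]
  refine Finset.sum_congr rfl fun k _ => ?_
  rw [Matrix.mul_diagonal, Matrix.conjTranspose_apply, overlap, Complex.star_def]
  generalize (b.Uᴴ * a.U) j k = z
  simp only [Complex.mul_re, Complex.mul_im, Complex.conj_re, Complex.conj_im,
    Complex.ofReal_re, Complex.ofReal_im, Complex.normSq_apply]
  ring

/-- Umegaki's relative entropy (with natural logarithms) in terms of diagonalizations. -/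
def relEntropy (a : Diagonalization ρ) (b : Diagonalization σ) : ℝ :=
  ∑ j, ∑ k, overlap a b j k * (a.d k * (Real.log (a.d k) - Real.log (b.d j)))

theorem relEntropy_eq (a : Diagonalization ρ) (b : Diagonalization σ) :
    relEntropy a b = -(Real.log 2 * entropy ρ) -
      (ρ * (b.U * Matrix.diagonal (fun j => (Real.log (b.d j) : ℂ)) * b.Uᴴ)).trace.re := by
  rw [← sum_overlap_mul a b fun j => Real.log (b.d j), a.entropy_eq]
  have h : ∑ j, ∑ k, overlap a b j k * (a.d k * Real.log (a.d k)) =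
      -(Real.log 2 * ∑ k, eta (a.d k)) := by
    rw [Finset.sum_comm, Finset.mul_sum, ← Finset.sum_neg_distrib]
    refine Finset.sum_congr rfl fun k _ => ?_
    rw [← Finset.sum_mul, sum_overlap_left, eta, Real.negMulLog]
    have : Real.log 2 ≠ 0 := (Real.log_pos (by norm_num)).ne'
    field_simp
  rw [← h, relEntropy, ← Finset.sum_sub_distrib]
  refine Finset.sum_congr rfl fun j _ => ?_
  rw [← Finset.sum_sub_distrib]
  exact Finset.sum_congr rfl fun k _ => by ring

/-- **Klein's inequality.** -/
theorem trace_sub_trace_le_relEntropy (a : Diagonalization ρ) (b : Diagonalization σ)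
    (ha : ∀ i, 0 < a.d i) (hb : ∀ i, 0 < b.d i) :
    ρ.trace.re - σ.trace.re ≤ relEntropy a b := by
  have h : ρ.trace.re - σ.trace.re = ∑ j, ∑ k, overlap a b j k * (a.d k - b.d j) := by
    simp only [mul_sub, Finset.sum_sub_distrib]
    rw [a.trace_re, b.trace_re]
    congr 1
    · rw [Finset.sum_comm]
      exact Finset.sum_congr rfl fun k _ => by rw [← Finset.sum_mul, sum_overlap_left, one_mul]
    · exact Finset.sum_congr rfl fun k _ => by rw [← Finset.sum_mul, sum_overlap_right, one_mul]
  rw [h]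
  refine Finset.sum_le_sum fun j _ => Finset.sum_le_sum fun k _ =>
    mul_le_mul_of_nonneg_left ?_ (overlap_nonneg _ _ _ _)
  -- Termwise, with `r = a.d k` and `s = b.d j`, the claim `r - s ≤ r (log r - log s)` is `log u ≤ u
  -- - 1` at `u = s / r`.
  have h1 := Real.log_le_sub_one_of_pos (div_pos (hb j) (ha k))
  rw [Real.log_div (hb j).ne' (ha k).ne'] at h1
  have h2 := mul_le_mul_of_nonneg_left h1 (ha k).le
  have h3 : a.d k * (b.d j / a.d k - 1) = b.d j - a.d k := by
    have := (ha k).ne'; field_simp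
  linarith

/-- The quadratic functional whose supremum over `Y` is the resolvent form of the relative
entropy. -/
def resolventForm (t : ℝ) (Y ρ σ : Matrix A A ℂ) : ℝ :=
  2 * (Yᴴ * ρ).trace.re - (Yᴴ * σ * Y).trace.re - t * (Yᴴ * Y * ρ).trace.re

/-- The resolvent form `⟨ρ, (L_σ + t R_ρ)⁻¹ ρ⟩`. -/
def resolventSum (t : ℝ) (a : Diagonalization ρ) (b : Diagonalization σ) : ℝ :=
  ∑ j, ∑ k, overlap a b j k * (a.d k ^ 2 / (b.d j + t * a.d k))

theorem re_trace_conjTranspose_mul (X Y : Matrix A A ℂ) :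
    (Xᴴ * Y).trace.re = ∑ j, ∑ k, (star (X j k) * Y j k).re := by
  rw [Matrix.trace, Complex.re_sum, Finset.sum_comm]
  refine Finset.sum_congr rfl fun k _ => ?_
  rw [Matrix.diag_apply, Matrix.mul_apply, Complex.re_sum]
  rfl

/-- In the coordinates `y = V* Y U`, given by the eigenbases `V` of `σ` and `U` of `ρ`, the
quadratic form decouples into one scalar problem for each matrix entry. -/
theorem resolventForm_conj (t : ℝ) (a : Diagonalization ρ) (b : Diagonalization σ)
    (y : Matrix A A ℂ) :
    resolventForm t (b.U * y * a.Uᴴ) ρ σ = ∑ j, ∑ k,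
      (2 * (star (y j k) * (b.Uᴴ * a.U) j k).re * a.d k -
        Complex.normSq (y j k) * (b.d j + t * a.d k)) := by
  set R := Matrix.diagonal (fun i => (a.d i : ℂ)) with hR
  set S := Matrix.diagonal (fun i => (b.d i : ℂ)) with hS
  have hY : (b.U * y * a.Uᴴ)ᴴ = a.U * yᴴ * b.Uᴴ := by
    simp only [Matrix.conjTranspose_mul, Matrix.conjTranspose_conjTranspose, Matrix.mul_assoc]
  have ea : ∀ Z : Matrix A A ℂ, a.Uᴴ * (a.U * Z) = Z := fun Z => by
    rw [← Matrix.mul_assoc, a.star_mul, Matrix.one_mul]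
  have eb : ∀ Z : Matrix A A ℂ, b.Uᴴ * (b.U * Z) = Z := fun Z => by
    rw [← Matrix.mul_assoc, b.star_mul, Matrix.one_mul]
  have h1 : ((b.U * y * a.Uᴴ)ᴴ * ρ).trace = (yᴴ * ((b.Uᴴ * a.U) * R)).trace := by
    rw [hY]
    refine (congrArg (fun Z => (a.U * yᴴ * b.Uᴴ * Z).trace) a.eq).trans ?_
    rw [← Matrix.mul_assoc, Matrix.trace_mul_comm]
    simp only [Matrix.mul_assoc, ea, hR]
  have h2 : ((b.U * y * a.Uᴴ)ᴴ * σ * (b.U * y * a.Uᴴ)).trace = (yᴴ * (S * y)).trace := by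
    rw [hY]
    refine (congrArg (fun Z => (a.U * yᴴ * b.Uᴴ * Z * (b.U * y * a.Uᴴ)).trace) b.eq).trans ?_
    rw [← Matrix.mul_assoc (_ * _) (b.U * y), Matrix.trace_mul_comm]
    simp only [Matrix.mul_assoc, ea, eb, hS]
  have h3 : ((b.U * y * a.Uᴴ)ᴴ * (b.U * y * a.Uᴴ) * ρ).trace = (yᴴ * (y * R)).trace := by
    rw [hY]
    refine (congrArg (fun Z => (a.U * yᴴ * b.Uᴴ * (b.U * y * a.Uᴴ) * Z).trace) a.eq).trans ?_
    rw [← Matrix.mul_assoc, Matrix.trace_mul_comm]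
    simp only [Matrix.mul_assoc, ea, eb, hR]
  rw [resolventForm, h1, h2, h3, re_trace_conjTranspose_mul, re_trace_conjTranspose_mul,
    re_trace_conjTranspose_mul, Finset.mul_sum, Finset.mul_sum, ← Finset.sum_sub_distrib,
    ← Finset.sum_sub_distrib]
  refine Finset.sum_congr rfl fun j _ => ?_
  rw [Finset.mul_sum, Finset.mul_sum, ← Finset.sum_sub_distrib, ← Finset.sum_sub_distrib]
  refine Finset.sum_congr rfl fun k _ => ?_
  rw [hR, hS, Matrix.mul_diagonal, Matrix.diagonal_mul, Matrix.mul_diagonal]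
  simp only [Complex.star_def, Complex.mul_re, Complex.mul_im, Complex.conj_re, Complex.conj_im,
    Complex.ofReal_re, Complex.ofReal_im, Complex.normSq_apply]
  ring

/-- Completing the square: the difference of the two sides is `|m y - r o|² / m`. -/
theorem two_mul_re_sub_le {y o : ℂ} {r m : ℝ} (hm : 0 < m) :
    2 * (star y * o).re * r - Complex.normSq y * m ≤ Complex.normSq o * (r ^ 2 / m) := by
  have h : 0 ≤ Complex.normSq (m * y - r * o) / m := div_nonneg (Complex.normSq_nonneg _) hm.le
  have e : Complex.normSq (m * y - r * o) / m =
      Complex.normSq y * m - 2 * (star y * o).re * r + Complex.normSq o * (r ^ 2 / m) := by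
    simp only [Complex.star_def, Complex.mul_re, Complex.mul_im, Complex.conj_re, Complex.conj_im,
      Complex.ofReal_re, Complex.ofReal_im, Complex.normSq_apply, Complex.sub_re, Complex.sub_im]
    field_simp
    ring
  linarith

theorem resolventForm_le (t : ℝ) (ht : 0 ≤ t) (a : Diagonalization ρ) (b : Diagonalization σ)
    (ha : ∀ i, 0 < a.d i) (hb : ∀ i, 0 < b.d i) (Y : Matrix A A ℂ) :
    resolventForm t Y ρ σ ≤ resolventSum t a b := by
  have hY : Y = b.U * (b.Uᴴ * Y * a.U) * a.Uᴴ := by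
    simp only [Matrix.mul_assoc, a.mul_star, Matrix.mul_one]
    rw [← Matrix.mul_assoc, b.mul_star, Matrix.one_mul]
  rw [hY, resolventForm_conj]
  exact Finset.sum_le_sum fun j _ => Finset.sum_le_sum fun k _ =>
    two_mul_re_sub_le (add_pos_of_pos_of_nonneg (hb j) (mul_nonneg ht (ha k).le))

theorem exists_resolventForm_eq (t : ℝ) (ht : 0 ≤ t) (a : Diagonalization ρ)
    (b : Diagonalization σ) (ha : ∀ i, 0 < a.d i) (hb : ∀ i, 0 < b.d i) :
    ∃ Y, resolventForm t Y ρ σ = resolventSum t a b := by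
  -- The entrywise maximizer `y = r o / m` annihilates the square; as an operator, `Y = (L_σ + t
  -- R_ρ)⁻¹ ρ`.
  refine ⟨b.U * Matrix.of (fun j k => ((a.d k / (b.d j + t * a.d k) : ℝ) : ℂ) *
    (b.Uᴴ * a.U) j k) * a.Uᴴ, ?_⟩
  rw [resolventForm_conj]
  refine Finset.sum_congr rfl fun j _ => Finset.sum_congr rfl fun k _ => ?_
  have hm : b.d j + t * a.d k ≠ 0 :=
    (add_pos_of_pos_of_nonneg (hb j) (mul_nonneg ht (ha k).le)).ne'
  rw [overlap, Matrix.of_apply]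
  generalize (b.Uᴴ * a.U) j k = o
  generalize b.d j + t * a.d k = m at hm ⊢
  simp only [Complex.star_def, Complex.mul_re, Complex.mul_im, Complex.conj_re, Complex.conj_im,
      Complex.ofReal_re, Complex.ofReal_im, Complex.normSq_apply]
  field_simp
  ring

/-- For fixed `Y` the form is linear in the pair `(ρ, σ)`; a supremum of such forms is subadditive,
and this is the source of the joint subadditivity. -/
theorem resolventForm_sum {ι : Type*} (s : Finset ι) (t : ℝ) (Y : Matrix A A ℂ)
    (ρ σ : ι → Matrix A A ℂ) :
    resolventForm t Y (∑ i ∈ s, ρ i) (∑ i ∈ s, σ i) = ∑ i ∈ s, resolventForm t Y (ρ i) (σ i) := by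
  simp only [resolventForm, Finset.mul_sum, Finset.sum_mul, Matrix.trace_sum, Complex.re_sum,
    Finset.sum_sub_distrib]

theorem integral_sq_div_add {r s T : ℝ} (hr : 0 < r) (hs : 0 < s) (hT : 0 ≤ T) :
    IntervalIntegrable (fun t => r ^ 2 / (s + t * r)) MeasureTheory.volume 0 T ∧
    ∫ t in (0 : ℝ)..T, r ^ 2 / (s + t * r) = r * (Real.log (s + T * r) - Real.log s) := by
  have hpos : ∀ t ∈ Set.uIcc 0 T, s + t * r ≠ 0 := by
    intro t ht
    rw [Set.uIcc_of_le hT] at ht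
    exact (add_pos_of_pos_of_nonneg hs (mul_nonneg ht.1 hr.le)).ne'
  have hI : IntervalIntegrable (fun t => r ^ 2 / (s + t * r)) MeasureTheory.volume 0 T := by
    apply ContinuousOn.intervalIntegrable
    exact ContinuousOn.div (by fun_prop) (by fun_prop) hpos
  refine ⟨hI, ?_⟩
  have hd : ∀ t ∈ Set.uIcc 0 T, HasDerivAt (fun t => r * Real.log (s + t * r))
      (r ^ 2 / (s + t * r)) t := by
    intro t ht
    have h1 : HasDerivAt (fun t => s + t * r) r t := by
      simpa using ((hasDerivAt_id t).mul_const r).const_add s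
    have h2 := (h1.log (hpos t ht)).const_mul r
    have e : r ^ 2 / (s + t * r) = r * (r / (s + t * r)) := by rw [sq, mul_div_assoc]
    rw [e]
    exact h2
  rw [intervalIntegral.integral_eq_sub_of_hasDerivAt hd hI]
  simp only [zero_mul, add_zero, mul_sub]

theorem integral_resolventSum (a : Diagonalization ρ) (b : Diagonalization σ)
    (ha : ∀ i, 0 < a.d i) (hb : ∀ i, 0 < b.d i) {T : ℝ} (hT : 0 ≤ T) :
    IntervalIntegrable (fun t => resolventSum t a b) MeasureTheory.volume 0 T ∧
    ∫ t in (0 : ℝ)..T, resolventSum t a b = ∑ j, ∑ k, overlap a b j k *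
      (a.d k * (Real.log (b.d j + T * a.d k) - Real.log (b.d j))) := by
  have h := fun j k => integral_sq_div_add (ha k) (hb j) hT
  have hI : ∀ j k, IntervalIntegrable (fun t => overlap a b j k *
      (a.d k ^ 2 / (b.d j + t * a.d k))) MeasureTheory.volume 0 T :=
    fun j k => (h j k).1.const_mul _
  have hI2 : ∀ j, IntervalIntegrable (fun t => ∑ k, overlap a b j k *
      (a.d k ^ 2 / (b.d j + t * a.d k))) MeasureTheory.volume 0 T := by
    intro j
    have := IntervalIntegrable.sum Finset.univ fun k _ => hI j k
    simpa only [Finset.sum_fn] using this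
  refine ⟨?_, ?_⟩
  · have := IntervalIntegrable.sum Finset.univ fun j _ => hI2 j
    simpa only [Finset.sum_fn, resolventSum] using this
  · simp only [resolventSum]
    rw [intervalIntegral.integral_finsetSum fun j _ => hI2 j]
    refine Finset.sum_congr rfl fun j _ => ?_
    rw [intervalIntegral.integral_finsetSum fun k _ => hI j k]
    refine Finset.sum_congr rfl fun k _ => ?_
    rw [intervalIntegral.integral_const_mul, (h j k).2]

/-- A regularization of the relative entropy, which it approaches as `T → ∞`. -/
def regRelEntropy (T : ℝ) (a : Diagonalization ρ) (b : Diagonalization σ) : ℝ :=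
  ∑ j, ∑ k, overlap a b j k * (a.d k * (Real.log (b.d j / T + a.d k) - Real.log (b.d j)))

/-- The integral diverges as `T → ∞`, but its divergent part `log T · tr ρ` is additive in `ρ` and
cancels when a sum is compared with its terms. -/
theorem integral_resolventSum_eq_reg (a : Diagonalization ρ) (b : Diagonalization σ)
    (ha : ∀ i, 0 < a.d i) (hb : ∀ i, 0 < b.d i) {T : ℝ} (hT : 0 < T) :
    ∫ t in (0 : ℝ)..T, resolventSum t a b = regRelEntropy T a b + Real.log T * ρ.trace.re := by
  have h : Real.log T * ρ.trace.re = ∑ j, ∑ k, overlap a b j k * (a.d k * Real.log T) := by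
    rw [Finset.sum_comm, a.trace_re, Finset.mul_sum]
    refine Finset.sum_congr rfl fun k _ => ?_
    rw [← Finset.sum_mul, sum_overlap_left]; ring
  rw [(integral_resolventSum a b ha hb hT.le).2, h, regRelEntropy, ← Finset.sum_add_distrib]
  refine Finset.sum_congr rfl fun j _ => ?_
  rw [← Finset.sum_add_distrib]
  refine Finset.sum_congr rfl fun k _ => ?_
  have e : b.d j + T * a.d k = T * (b.d j / T + a.d k) := by field_simp
  rw [e, Real.log_mul hT.ne' (add_pos (div_pos (hb j) hT) (ha k)).ne']
  ring

theorem tendsto_regRelEntropy (a : Diagonalization ρ) (b : Diagonalization σ)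
    (ha : ∀ i, 0 < a.d i) :
    Tendsto (fun T => regRelEntropy T a b) atTop (𝓝 (relEntropy a b)) := by
  refine tendsto_finsetSum _ fun j _ => tendsto_finsetSum _ fun k _ => ?_
  refine (((Tendsto.log ?_ (ha k).ne').sub_const _).const_mul _).const_mul _
  simpa using (tendsto_const_nhds (x := b.d j)).div_atTop tendsto_id |>.add_const (a.d k)

/-- **Joint subadditivity of the relative entropy** for positive definite matrices. -/
theorem relEntropy_sum_le {ι : Type*} (s : Finset ι) {ρ σ : ι → Matrix A A ℂ}
    (a : ∀ i, Diagonalization (ρ i)) (b : ∀ i, Diagonalization (σ i))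
    (ha : ∀ i k, 0 < (a i).d k) (hb : ∀ i k, 0 < (b i).d k)
    {ρ' σ' : Matrix A A ℂ} (hρ' : ρ' = ∑ i ∈ s, ρ i) (hσ' : σ' = ∑ i ∈ s, σ i)
    (a' : Diagonalization ρ') (b' : Diagonalization σ')
    (ha' : ∀ k, 0 < a'.d k) (hb' : ∀ k, 0 < b'.d k) :
    relEntropy a' b' ≤ ∑ i ∈ s, relEntropy (a i) (b i) := by
  subst hρ' hσ'
  refine le_of_tendsto_of_tendsto (tendsto_regRelEntropy a' b' ha')
    (tendsto_finsetSum s fun i _ => tendsto_regRelEntropy (a i) (b i) (ha i)) ?_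
  filter_upwards [eventually_gt_atTop 0] with T hT
  have hmono : ∫ t in (0 : ℝ)..T, resolventSum t a' b' ≤
      ∫ t in (0 : ℝ)..T, ∑ i ∈ s, resolventSum t (a i) (b i) := by
    refine intervalIntegral.integral_mono_on hT.le
      (integral_resolventSum a' b' ha' hb' hT.le).1 ?_ fun t ht => ?_
    · have := IntervalIntegrable.sum s fun i _ =>
        (integral_resolventSum (a i) (b i) (ha i) (hb i) hT.le).1
      simpa only [Finset.sum_fn] using this
    -- The `Y` that is optimal for the sums is merely admissible for each summand.
    · obtain ⟨Y, hY⟩ := exists_resolventForm_eq t ht.1 a' b' ha' hb'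
      rw [← hY, resolventForm_sum]
      exact Finset.sum_le_sum fun i _ => resolventForm_le t ht.1 (a i) (b i) (ha i) (hb i) Y
  rw [intervalIntegral.integral_finsetSum fun i _ =>
      (integral_resolventSum (a i) (b i) (ha i) (hb i) hT.le).1,
    integral_resolventSum_eq_reg a' b' ha' hb' hT,
    Finset.sum_congr rfl fun i _ => integral_resolventSum_eq_reg (a i) (b i) (ha i) (hb i) hT,
    Finset.sum_add_distrib, ← Finset.mul_sum, Matrix.trace_sum, Complex.re_sum] at hmono
  linarith

end RelativeEntropy

/-! ### Partial traces, subadditivity and strong subadditivity -/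

section PartialTrace

variable {A E : Type*} [Fintype A] [DecidableEq A] [Fintype E] [DecidableEq E]

/-- The partial trace over the first tensor factor. -/
def traceLeft : Matrix (A × E) (A × E) ℂ →ₗ[ℂ] Matrix E E ℂ where
  toFun ρ := ∑ a, ρ.submatrix (fun e => (a, e)) (fun e => (a, e))
  map_add' ρ σ := by simp only [Matrix.submatrix_add, Pi.add_apply, Finset.sum_add_distrib]
  map_smul' c ρ := by
    simp only [Matrix.submatrix_smul, Pi.smul_apply, Finset.smul_sum, RingHom.id_apply]

/-- The partial trace over the second tensor factor. -/
def traceRight : Matrix (A × E) (A × E) ℂ →ₗ[ℂ] Matrix A A ℂ where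
  toFun ρ := ∑ e, ρ.submatrix (fun a => (a, e)) (fun a => (a, e))
  map_add' ρ σ := by simp only [Matrix.submatrix_add, Pi.add_apply, Finset.sum_add_distrib]
  map_smul' c ρ := by
    simp only [Matrix.submatrix_smul, Pi.smul_apply, Finset.smul_sum, RingHom.id_apply]

theorem traceLeft_apply (ρ : Matrix (A × E) (A × E) ℂ) (e e' : E) :
    traceLeft ρ e e' = ∑ a, ρ (a, e) (a, e') := by
  exact Matrix.sum_apply _ _ _ _

theorem traceRight_apply (ρ : Matrix (A × E) (A × E) ℂ) (a a' : A) :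
    traceRight ρ a a' = ∑ e, ρ (a, e) (a', e) := by
  exact Matrix.sum_apply _ _ _ _

theorem posSemidef_traceLeft {ρ : Matrix (A × E) (A × E) ℂ} (h : ρ.PosSemidef) :
    (traceLeft ρ).PosSemidef :=
  Matrix.posSemidef_sum _ fun _ _ => h.submatrix _

theorem posSemidef_traceRight {ρ : Matrix (A × E) (A × E) ℂ} (h : ρ.PosSemidef) :
    (traceRight ρ).PosSemidef :=
  Matrix.posSemidef_sum _ fun _ _ => h.submatrix _

theorem posDef_traceLeft [Nonempty A] {ρ : Matrix (A × E) (A × E) ℂ} (h : ρ.PosDef) :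
    (traceLeft ρ).PosDef :=
  Matrix.posDef_sum Finset.univ_nonempty fun _ _ => h.submatrix fun _ _ h => (Prod.mk.inj h).2

theorem posDef_traceRight [Nonempty E] {ρ : Matrix (A × E) (A × E) ℂ} (h : ρ.PosDef) :
    (traceRight ρ).PosDef :=
  Matrix.posDef_sum Finset.univ_nonempty fun _ _ => h.submatrix fun _ _ h => (Prod.mk.inj h).1

theorem trace_traceLeft (ρ : Matrix (A × E) (A × E) ℂ) : (traceLeft ρ).trace = ρ.trace := by
  simp only [Matrix.trace, Matrix.diag_apply, traceLeft_apply]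
  rw [Finset.sum_comm, Fintype.sum_prod_type]

theorem trace_traceRight (ρ : Matrix (A × E) (A × E) ℂ) : (traceRight ρ).trace = ρ.trace := by
  simp only [Matrix.trace, Matrix.diag_apply, traceRight_apply, Fintype.sum_prod_type]

theorem traceLeft_kronecker (ρ : Matrix A A ℂ) (σ : Matrix E E ℂ) :
    traceLeft (ρ ⊗ₖ σ) = ρ.trace • σ := by
  ext e e'
  simp [traceLeft_apply, Matrix.trace, Finset.sum_mul]

theorem trace_mul_one_kronecker (ρ : Matrix (A × E) (A × E) ℂ) (Z : Matrix E E ℂ) :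
    (ρ * ((1 : Matrix A A ℂ) ⊗ₖ Z)).trace = (traceLeft ρ * Z).trace := by
  simp only [Matrix.trace, Matrix.diag_apply, Matrix.mul_apply, Fintype.sum_prod_type,
    Matrix.kroneckerMap_apply, traceLeft_apply, Matrix.one_apply, ite_mul, one_mul, zero_mul,
    mul_ite, mul_zero, Finset.sum_mul]
  rw [Finset.sum_comm]
  refine Finset.sum_congr rfl fun e _ => ?_
  conv_rhs => rw [Finset.sum_comm]
  refine Finset.sum_congr rfl fun a _ => ?_
  rw [Finset.sum_comm]
  simp

theorem trace_mul_kronecker_one (ρ : Matrix (A × E) (A × E) ℂ) (Z : Matrix A A ℂ) :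
    (ρ * (Z ⊗ₖ (1 : Matrix E E ℂ))).trace = (traceRight ρ * Z).trace := by
  simp only [Matrix.trace, Matrix.diag_apply, Matrix.mul_apply, Fintype.sum_prod_type,
    Matrix.kroneckerMap_apply, traceRight_apply, Matrix.one_apply,
    mul_ite, mul_zero, mul_one, Finset.sum_mul]
  refine Finset.sum_congr rfl fun e _ => ?_
  rw [Finset.sum_comm]
  refine Finset.sum_congr rfl fun a _ => ?_
  simp

theorem Diagonalization.trace_mul_log {ρ : Matrix A A ℂ} (a : Diagonalization ρ) :
    (ρ * (a.U * Matrix.diagonal (fun j => (Real.log (a.d j) : ℂ)) * a.Uᴴ)).trace.re =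
      -(Real.log 2 * entropy ρ) := by
  have h : (ρ * (a.U * Matrix.diagonal (fun j => (Real.log (a.d j) : ℂ)) * a.Uᴴ)).trace =
      ((Matrix.diagonal fun j => (a.d j : ℂ)) *
        Matrix.diagonal fun j => (Real.log (a.d j) : ℂ)).trace := by
    refine (congrArg (fun Z => (Z * (a.U * Matrix.diagonal (fun j => (Real.log (a.d j) : ℂ)) *
      a.Uᴴ)).trace) a.eq).trans ?_
    have ea : ∀ Z : Matrix A A ℂ, a.Uᴴ * (a.U * Z) = Z := fun Z => by
      rw [← Matrix.mul_assoc, a.star_mul, Matrix.one_mul]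
    rw [← Matrix.mul_assoc, Matrix.trace_mul_comm]
    simp only [Matrix.mul_assoc, ea]
  rw [h, a.entropy_eq, Matrix.diagonal_mul_diagonal, Matrix.trace_diagonal, Complex.re_sum,
    Finset.mul_sum, ← Finset.sum_neg_distrib]
  refine Finset.sum_congr rfl fun j _ => ?_
  rw [← Complex.ofReal_mul, Complex.ofReal_re, eta, Real.negMulLog]
  have : Real.log 2 ≠ 0 := (Real.log_pos (by norm_num)).ne'
  field_simp

/-- Since `log (1 ⊗ σ) = 1 ⊗ log σ`, the relative entropy to `1 ⊗ traceLeft ρ` is, up to the factor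
`log 2`, minus the conditional entropy. Joint subadditivity thereby becomes strong subadditivity. -/
theorem relEntropy_one_kronecker {ρ : Matrix (A × E) (A × E) ℂ} (a : Diagonalization ρ)
    (b : Diagonalization (traceLeft ρ)) :
    relEntropy a (Diagonalization.one.kronecker b) =
      Real.log 2 * (entropy (traceLeft ρ) - entropy ρ) := by
  have h := kronecker_conj_diagonal (1 : Matrix A A ℂ) b.U (fun _ => 1) fun j => Real.log (b.d j)
  simp only [Complex.ofReal_one, Matrix.diagonal_one, Matrix.conjTranspose_one,
    one_mul] at h
  rw [relEntropy_eq]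
  simp only [Diagonalization.kronecker, Diagonalization.one, one_mul]
  rw [← h, trace_mul_one_kronecker, b.trace_mul_log]
  ring

/-- The logarithm of a product of positive operators splits as `log b ⊗ 1 + 1 ⊗ log c`, and each
term sees one marginal. The result is the quantum mutual information in nats. -/
theorem relEntropy_kronecker {ρ : Matrix (A × E) (A × E) ℂ} (a : Diagonalization ρ)
    (b : Diagonalization (traceRight ρ)) (c : Diagonalization (traceLeft ρ))
    (hb : ∀ i, 0 < b.d i) (hc : ∀ i, 0 < c.d i) :
    relEntropy a (b.kronecker c) =
      Real.log 2 * (entropy (traceRight ρ) + entropy (traceLeft ρ) - entropy ρ) := by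
  have h1 := kronecker_conj_diagonal b.U c.U (fun _ => 1) fun j => Real.log (c.d j)
  have h2 := kronecker_conj_diagonal b.U c.U (fun j => Real.log (b.d j)) fun _ => 1
  simp only [Complex.ofReal_one, Matrix.diagonal_one, b.mul_star, c.mul_star,
    one_mul, mul_one] at h1 h2
  have h3 : Matrix.diagonal (fun i : A × E => (Real.log (b.d i.1 * c.d i.2) : ℂ)) =
      Matrix.diagonal (fun i : A × E => (Real.log (b.d i.1) : ℂ)) +
      Matrix.diagonal (fun i : A × E => (Real.log (c.d i.2) : ℂ)) := by
    rw [Matrix.diagonal_add]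
    congr 1
    ext i
    rw [Real.log_mul (hb i.1).ne' (hc i.2).ne', Complex.ofReal_add]
  rw [relEntropy_eq]
  simp only [Diagonalization.kronecker]
  rw [h3, Matrix.mul_add, Matrix.add_mul, ← h1, ← h2, Matrix.mul_add, Matrix.trace_add,
    trace_mul_one_kronecker, trace_mul_kronecker_one, Complex.add_re, b.trace_mul_log,
    c.trace_mul_log]
  ring

theorem posDef_add_smul_one {ρ : Matrix A A ℂ} (h : ρ.PosSemidef) {ε : ℝ} (hε : 0 < ε) :
    (ρ + (ε : ℂ) • (1 : Matrix A A ℂ)).PosDef :=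
  Matrix.PosDef.posSemidef_add h (Matrix.PosDef.one.smul (by exact_mod_cast hε))

theorem isHermitian_add_smul_one {ρ σ : Matrix A A ℂ} (h : ρ.IsHermitian) (hσ : σ.IsHermitian)
    (ε : ℝ) : (ρ + (ε : ℂ) • σ).IsHermitian := by
  refine h.add ?_
  rw [Matrix.IsHermitian, Matrix.conjTranspose_smul, hσ.eq]
  simp

theorem tendsto_entropy_add_smul {ρ σ : Matrix A A ℂ} (h : ρ.IsHermitian) (hσ : σ.IsHermitian) :
    Tendsto (fun ε : ℝ => entropy (ρ + (ε : ℂ) • σ)) (𝓝[>] 0) (𝓝 (entropy ρ)) := by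
  have hc : Continuous fun ε : ℝ => entropy (ρ + (ε : ℂ) • σ) :=
    continuousOn_entropy.comp_continuous (by fun_prop) fun ε => isHermitian_add_smul_one h hσ ε
  have := (hc.tendsto 0).mono_left (nhdsWithin_le_nhds (s := Set.Ioi 0))
  simpa using this

theorem isHermitian_traceLeft {ρ : Matrix (A × E) (A × E) ℂ} (h : ρ.IsHermitian) :
    (traceLeft ρ).IsHermitian := by
  ext e e'
  simp only [Matrix.conjTranspose_apply, traceLeft_apply, star_sum]
  exact Finset.sum_congr rfl fun a _ => h.apply _ _

theorem isHermitian_traceRight {ρ : Matrix (A × E) (A × E) ℂ} (h : ρ.IsHermitian) :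
    (traceRight ρ).IsHermitian := by
  ext e e'
  simp only [Matrix.conjTranspose_apply, traceRight_apply, star_sum]
  exact Finset.sum_congr rfl fun a _ => h.apply _ _

/-- **Subadditivity of the entropy**. -/
theorem entropy_le_add [Nonempty A] [Nonempty E] {ρ : Matrix (A × E) (A × E) ℂ} (hρ : IsState ρ) :
    entropy ρ ≤ entropy (traceRight ρ) + entropy (traceLeft ρ) := by
  have hH := hρ.1.isHermitian
  have h1 : (1 : Matrix (A × E) (A × E) ℂ).IsHermitian := Matrix.isHermitian_one
  have hlog : 0 < Real.log 2 := Real.log_pos (by norm_num)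
  set N : ℝ := (Fintype.card (A × E) : ℝ) with hN
  -- After adding `ε · 1` the trace is `t = 1 + ε N`, while the product of the marginals has trace
  -- `t²`. Klein's inequality thus leaves the error `(t² - t) / log 2`, which vanishes in the limit.
  have hR : Tendsto (fun ε : ℝ => (1 + ε * N) * (1 + ε * N) / Real.log 2 - (1 + ε * N) / Real.log 2)
      (𝓝[>] 0) (𝓝 0) := by
    have hc : Continuous fun ε : ℝ =>
        (1 + ε * N) * (1 + ε * N) / Real.log 2 - (1 + ε * N) / Real.log 2 := by fun_prop
    have := (hc.tendsto 0).mono_left (nhdsWithin_le_nhds (s := Set.Ioi 0))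
    simpa using this
  have hlim := ((tendsto_entropy_add_smul (isHermitian_traceRight hH)
    (isHermitian_traceRight h1)).add (tendsto_entropy_add_smul (isHermitian_traceLeft hH)
    (isHermitian_traceLeft h1))).add hR
  rw [add_zero] at hlim
  refine le_of_tendsto_of_tendsto (tendsto_entropy_add_smul hH h1) hlim ?_
  filter_upwards [self_mem_nhdsWithin] with ε hε
  have hpos := posDef_add_smul_one hρ.1 hε
  rw [← map_smul, ← map_smul, ← map_add, ← map_add]
  have htr : (ρ + (ε : ℂ) • (1 : Matrix (A × E) (A × E) ℂ)).trace = ((1 + ε * N : ℝ) : ℂ) := by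
    rw [Matrix.trace_add, Matrix.trace_smul, hρ.2, Matrix.trace_one, hN]
    push_cast; simp
  set τ := ρ + (ε : ℂ) • (1 : Matrix (A × E) (A × E) ℂ) with hτ
  obtain ⟨a, ha⟩ := exists_diagonalization_posDef hpos
  obtain ⟨b, hb⟩ := exists_diagonalization_posDef (posDef_traceRight hpos)
  obtain ⟨c, hc⟩ := exists_diagonalization_posDef (posDef_traceLeft hpos)
  have hK := trace_sub_trace_le_relEntropy a (b.kronecker c) ha
    (fun i => mul_pos (hb i.1) (hc i.2))
  rw [relEntropy_kronecker a b c hb hc, Matrix.trace_kronecker, trace_traceLeft, trace_traceRight,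
    htr, ← Complex.ofReal_mul, Complex.ofReal_re, Complex.ofReal_re] at hK
  have hK2 := div_le_div_of_nonneg_right hK hlog.le
  rw [mul_div_cancel_left₀ _ hlog.ne', sub_div] at hK2
  linarith

/-- **Strong subadditivity**, in the form of the superadditivity of the conditional entropy
`ω ↦ S(ω) - S(tr_A ω)` on the cone of positive semidefinite matrices. -/
theorem sum_condEntropy_le {ι : Type*} [Fintype ι] [Nonempty ι] [Nonempty A]
    {ω : ι → Matrix (A × E) (A × E) ℂ} (hω : ∀ i, (ω i).PosSemidef) :
    ∑ i, (entropy (ω i) - entropy (traceLeft (ω i))) ≤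
      entropy (∑ i, ω i) - entropy (traceLeft (∑ i, ω i)) := by
  have h1 : (1 : Matrix (A × E) (A × E) ℂ).IsHermitian := Matrix.isHermitian_one
  have hlog : 0 < Real.log 2 := Real.log_pos (by norm_num)
  have hS : (∑ i, ω i).PosSemidef := Matrix.posSemidef_sum _ fun i _ => hω i
  have hc : ((∑ _i : ι, (1 : Matrix (A × E) (A × E) ℂ))).IsHermitian := by
    simp [Matrix.IsHermitian]
  have hL := tendsto_finsetSum (Finset.univ : Finset ι) fun i _ =>
    (tendsto_entropy_add_smul (hω i).isHermitian h1).sub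
      (tendsto_entropy_add_smul (isHermitian_traceLeft (hω i).isHermitian)
        (isHermitian_traceLeft h1))
  have hR := (tendsto_entropy_add_smul hS.isHermitian hc).sub
      (tendsto_entropy_add_smul (isHermitian_traceLeft hS.isHermitian) (isHermitian_traceLeft hc))
  refine le_of_tendsto_of_tendsto hL hR ?_
  filter_upwards [self_mem_nhdsWithin] with ε hε
  have hpos := fun i => posDef_add_smul_one (hω i) hε
  have hposS : (∑ i, (ω i + (ε : ℂ) • (1 : Matrix (A × E) (A × E) ℂ))).PosDef :=
    Matrix.posDef_sum Finset.univ_nonempty fun i _ => hpos i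
  simp only [← map_smul, ← map_add, Finset.smul_sum, ← Finset.sum_add_distrib]
  choose a ha using fun i => exists_diagonalization_posDef (hpos i)
  choose b hb using fun i => exists_diagonalization_posDef (posDef_traceLeft (hpos i))
  obtain ⟨a', ha'⟩ := exists_diagonalization_posDef hposS
  obtain ⟨b', hb'⟩ := exists_diagonalization_posDef (posDef_traceLeft hposS)
  have hsum : (1 : Matrix A A ℂ) ⊗ₖ
      traceLeft (∑ i, (ω i + (ε : ℂ) • (1 : Matrix (A × E) (A × E) ℂ))) =
      ∑ i, (1 : Matrix A A ℂ) ⊗ₖ traceLeft (ω i + (ε : ℂ) • (1 : Matrix (A × E) (A × E) ℂ)) := by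
    rw [map_sum]
    ext x y
    simp only [Matrix.kroneckerMap_apply, Matrix.sum_apply, Finset.mul_sum]
  -- Joint subadditivity for the regularized pairs `(ω i, 1 ⊗ traceLeft (ω i))`; by linearity of the
  -- partial trace their sum is again such a pair.
  have key := relEntropy_sum_le Finset.univ a (fun i => Diagonalization.one.kronecker (b i)) ha
    (fun i k => by simpa [Diagonalization.kronecker, Diagonalization.one] using hb i k.2) rfl hsum
    a' (Diagonalization.one.kronecker b') ha'
    (fun k => by simpa [Diagonalization.kronecker, Diagonalization.one] using hb' k.2)
  rw [relEntropy_one_kronecker,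
    Finset.sum_congr rfl fun i _ => relEntropy_one_kronecker (a i) (b i), ← Finset.mul_sum,
    mul_le_mul_iff_right₀ hlog] at key
  have e := fun f g : ι → ℝ => Finset.sum_sub_distrib (s := Finset.univ) f g
  rw [e] at key ⊢
  linarith

end PartialTrace

/-! ### Kraus representations, complementary channels and purifications -/

section Channels

variable {A B A' B' E κ κ' : Type*} [Fintype A] [DecidableEq A] [Fintype B] [DecidableEq B]
  [Fintype A'] [DecidableEq A'] [Fintype B'] [DecidableEq B'] [Fintype E] [DecidableEq E]
  [Fintype κ] [DecidableEq κ] [Fintype κ'] [DecidableEq κ']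

theorem map_eq_sum_single (Φ : Matrix A A ℂ →ₗ[ℂ] Matrix B B ℂ) (X : Matrix A A ℂ) :
    Φ X = ∑ i, ∑ j, X i j • Φ (Matrix.single i j 1) := by
  conv_lhs => rw [Matrix.matrix_eq_sum_single X]
  simp only [map_sum]
  refine Finset.sum_congr rfl fun i _ => Finset.sum_congr rfl fun j _ => ?_
  rw [← map_smul, Matrix.smul_single, smul_eq_mul, mul_one]

/-- Linear maps on a tensor product of matrix spaces are determined by their values on products of
matrix units. -/
theorem linearMap_ext_kronecker {M : Type*} [AddCommGroup M] [Module ℂ M]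
    {Φ Ψ : Matrix (A × A') (A × A') ℂ →ₗ[ℂ] M}
    (h : ∀ (X : Matrix A A ℂ) (Y : Matrix A' A' ℂ), Φ (X ⊗ₖ Y) = Ψ (X ⊗ₖ Y)) : Φ = Ψ := by
  refine Matrix.ext_linearMap ℂ fun i j => LinearMap.ext_ring ?_
  have := h (Matrix.single i.1 j.1 1) (Matrix.single i.2 j.2 1)
  rw [Matrix.single_kronecker_single] at this
  simpa using this

/-- `Φ ⊗ I` acts separately on each block indexed by a pair of basis vectors of the reference
system. -/
theorem tensorMap_id_apply (Φ : Matrix A A ℂ →ₗ[ℂ] Matrix B B ℂ)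
    (X : Matrix (A × E) (A × E) ℂ) (b b' : B) (e e' : E) :
    tensorMap Φ (LinearMap.id : Matrix E E ℂ →ₗ[ℂ] _) X (b, e) (b', e') =
      Φ (X.submatrix (fun a => (a, e)) (fun a => (a, e'))) b b' := by
  rw [map_eq_sum_single Φ]
  simp only [tensorMap, LinearMap.coe_mk, AddHom.coe_mk, Matrix.sum_apply, Matrix.smul_apply,
    Matrix.kroneckerMap_apply, LinearMap.id_apply, Matrix.single_apply, Fintype.sum_prod_type,
    Matrix.submatrix_apply, smul_eq_mul]
  refine Finset.sum_congr rfl fun a _ => ?_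
  rw [Finset.sum_comm]
  refine Finset.sum_congr rfl fun a' _ => ?_
  simp [ite_and]

/-- The linear map `X ↦ K X K*`. -/
def conjMap (K : Matrix B A ℂ) : Matrix A A ℂ →ₗ[ℂ] Matrix B B ℂ where
  toFun X := K * X * Kᴴ
  map_add' X Y := by rw [Matrix.mul_add, Matrix.add_mul]
  map_smul' c X := by simp

/-- `Φ` has the Kraus representation `Φ(X) = ∑ K_k X K_k*` and is trace preserving. -/
def HasKraus (Φ : Matrix A A ℂ →ₗ[ℂ] Matrix B B ℂ) (K : κ → Matrix B A ℂ) : Prop :=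
  (∀ X, Φ X = ∑ k, K k * X * (K k)ᴴ) ∧ ∑ k, (K k)ᴴ * K k = 1

variable {Φ : Matrix A A ℂ →ₗ[ℂ] Matrix B B ℂ} {K : κ → Matrix B A ℂ}
  {Ψ : Matrix A' A' ℂ →ₗ[ℂ] Matrix B' B' ℂ} {L : κ' → Matrix B' A' ℂ}

theorem HasKraus.tensorMap (hΦ : HasKraus Φ K) (hΨ : HasKraus Ψ L) :
    HasKraus (tensorMap Φ Ψ) fun k : κ × κ' => K k.1 ⊗ₖ L k.2 := by
  constructor
  · intro X
    have h : QShannon.tensorMap Φ Ψ = ∑ k : κ × κ', conjMap (K k.1 ⊗ₖ L k.2) := by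
      refine linearMap_ext_kronecker fun X Y => ?_
      rw [tensorMap_kronecker, hΦ.1, hΨ.1, LinearMap.sum_apply, Fintype.sum_prod_type]
      simp only [conjMap, LinearMap.coe_mk, AddHom.coe_mk, Matrix.conjTranspose_kronecker,
        ← Matrix.mul_kronecker_mul]
      ext x y
      simp only [Matrix.sum_apply, Matrix.kroneckerMap_apply, Finset.sum_mul_sum]
    rw [h, LinearMap.sum_apply]
    rfl
  · simp only [Matrix.conjTranspose_kronecker, ← Matrix.mul_kronecker_mul, Fintype.sum_prod_type]
    ext x y
    have h1 := hΦ.2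
    have h2 := hΨ.2
    rw [← Matrix.one_kronecker_one, ← h1, ← h2]
    simp only [Matrix.sum_apply, Matrix.kroneckerMap_apply, Finset.sum_mul_sum]

theorem HasKraus.trace_map (h : HasKraus Φ K) (X : Matrix A A ℂ) : (Φ X).trace = X.trace := by
  rw [h.1, Matrix.trace_sum, Finset.sum_congr rfl fun k _ => Matrix.trace_mul_cycle (K k) X (K k)ᴴ]
  rw [← Matrix.trace_sum, ← Finset.sum_mul, h.2, Matrix.one_mul]

theorem HasKraus.posSemidef_map (h : HasKraus Φ K) {X : Matrix A A ℂ} (hX : X.PosSemidef) :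
    (Φ X).PosSemidef := by
  rw [h.1]
  exact Matrix.posSemidef_sum _ fun k _ => hX.mul_mul_conjTranspose_same (K k)

theorem HasKraus.isState_map (h : HasKraus Φ K) {X : Matrix A A ℂ} (hX : IsState X) :
    IsState (Φ X) := ⟨h.posSemidef_map hX.1, (h.trace_map X).trans hX.2⟩

theorem hasKraus_id : HasKraus (LinearMap.id : Matrix A A ℂ →ₗ[ℂ] _) fun _ : Unit => 1 := by
  constructor <;> simp

theorem IsState.nonempty {ρ : Matrix A A ℂ} (h : IsState ρ) : Nonempty A := by
  by_contra hA
  rw [not_nonempty_iff] at hA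
  simpa [Matrix.trace] using h.2

/-- The Choi–Kraus representation of a quantum channel. -/
theorem IsChannel.exists_hasKraus (h : IsChannel Φ) :
    ∃ (d : ℕ) (K : Fin d → Matrix B A ℂ), HasKraus Φ K := by
  let e := Fintype.equivFin A
  -- The unnormalized maximally entangled vector; the image of its projector is the Choi matrix,
  -- whose blocks are the values of `Φ` on matrix units.
  let ω : A × Fin (Fintype.card A) → ℂ := fun x => if e x.1 = x.2 then 1 else 0
  have hC := h.1 _ (Matrix.vecMulVec ω (star ω)) (Matrix.posSemidef_vecMulVec_self_star ω)
  have hCe : ∀ b b' a a', tensorMap Φ (LinearMap.id : Matrix (Fin (Fintype.card A)) _ ℂ →ₗ[ℂ] _)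
      (Matrix.vecMulVec ω (star ω)) (b, e a) (b', e a') = Φ (Matrix.single a a' 1) b b' := by
    intro b b' a a'
    rw [tensorMap_id_apply]
    refine congrArg (fun Z => Φ Z b b') (Matrix.ext fun x y => ?_)
    simp only [Matrix.submatrix_apply, Matrix.vecMulVec_apply, ω, Pi.star_apply,
      Matrix.single_apply, EmbeddingLike.apply_eq_iff_eq]
    simp only [@eq_comm _ x a, @eq_comm _ y a']
    by_cases h1 : a = x <;> by_cases h2 : a' = y <;> simp [h1, h2]
  obtain ⟨U, d, -, -, hU, hd, -⟩ := exists_conj_diagonal hC.isHermitian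
  have hd := hd hC
  -- Each eigenvector of the Choi matrix, scaled by the square root of its eigenvalue, is reshaped
  -- into a Kraus operator.
  let K : B × Fin (Fintype.card A) → Matrix B A ℂ := fun k =>
    Matrix.of fun b a => U (b, e a) k * (Real.sqrt (d k) : ℂ)
  have hK : ∀ X, Φ X = ∑ k, K k * X * (K k)ᴴ := by
    have hs : ∀ a a', Φ (Matrix.single a a' 1) = ∑ k, K k * Matrix.single a a' (1 : ℂ) * (K k)ᴴ := by
      intro a a'
      ext b b'
      rw [← hCe, hU, Matrix.mul_apply, Matrix.sum_apply]
      refine Finset.sum_congr rfl fun k _ => ?_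
      have hsq : (d k : ℂ) = (Real.sqrt (d k) : ℂ) * (Real.sqrt (d k) : ℂ) := by
        rw [← Complex.ofReal_mul, Real.mul_self_sqrt (hd k)]
      rw [Matrix.mul_diagonal, hsq]
      simp [Matrix.mul_apply, Matrix.single_apply, K, ite_and]
      ring
    intro X
    have h2 := map_eq_sum_single (∑ k, conjMap (K k)) X
    rw [LinearMap.sum_apply] at h2
    refine (map_eq_sum_single Φ X).trans (Eq.trans ?_ h2.symm)
    refine Finset.sum_congr rfl fun i _ => Finset.sum_congr rfl fun j _ => ?_
    rw [hs, LinearMap.sum_apply]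
    rfl
  have hTP : ∑ k, (K k)ᴴ * K k = 1 := by
    ext a' a
    have h2 := h.2 (Matrix.single a a' 1)
    rw [hK, Matrix.trace_sum,
      Finset.sum_congr rfl fun k _ => Matrix.trace_mul_cycle (K k) (Matrix.single a a' (1 : ℂ)) (K k)ᴴ,
      ← Matrix.trace_sum, ← Finset.sum_mul] at h2
    rw [Matrix.trace_mul_single] at h2
    have h3 : (Matrix.single a a' (1 : ℂ)).trace = (1 : Matrix A A ℂ) a' a := by
      rw [Matrix.one_apply]
      by_cases h : a' = a
      · subst h; simp
      · simp [h, Matrix.trace_single_eq_of_ne _ _ _ (Ne.symm h)]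
    rw [h3] at h2
    simpa using h2
  refine ⟨_, K ∘ (Fintype.equivFin _).symm, fun X => ?_, ?_⟩
  · rw [hK]
    exact ((Fintype.equivFin _).symm.sum_comp fun k => K k * X * (K k)ᴴ).symm
  · rw [← hTP]
    exact (Fintype.equivFin _).symm.sum_comp fun k => (K k)ᴴ * K k

/-- The complementary channel, mapping the input to the state of the environment. -/
def complement (K : κ → Matrix B A ℂ) : Matrix A A ℂ →ₗ[ℂ] Matrix κ κ ℂ where
  toFun X := Matrix.of fun k l => (K l * X * (K k)ᴴ).trace
  map_add' X Y := by ext; simp [Matrix.mul_add, Matrix.add_mul]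
  map_smul' c X := by ext; simp

theorem isHermitian_complement (K : κ → Matrix B A ℂ) {X : Matrix A A ℂ} (hX : X.IsHermitian) :
    (complement K X).IsHermitian := by
  ext k l
  simp only [complement, LinearMap.coe_mk, AddHom.coe_mk, Matrix.conjTranspose_apply,
    Matrix.of_apply, ← Matrix.trace_conjTranspose, Matrix.conjTranspose_mul,
    Matrix.conjTranspose_conjTranspose, hX.eq, Matrix.mul_assoc]

/-- The entropy exchange is the output entropy of the complementary channel; in particular it does
not depend on the purification. -/
theorem entropy_exchange (h : HasKraus Φ K) {φ : A × E → ℂ} {ρ : Matrix A A ℂ}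
    (hφ : IsPurification φ ρ) :
    entropy (tensorMap Φ (LinearMap.id : Matrix E E ℂ →ₗ[ℂ] _) (pureState φ)) =
      entropy (complement K ρ) := by
  -- The vector obtained from `φ` by the Stinespring isometry, reshaped into a matrix between output
  -- with reference and environment. One marginal is `G * Gᴴ`; the other, up to transposition, is
  -- `Gᴴ * G`.
  let G : Matrix (B × E) κ ℂ := Matrix.of fun x k => ∑ a, K k x.1 a * φ (a, x.2)
  have h1 : tensorMap Φ (LinearMap.id : Matrix E E ℂ →ₗ[ℂ] _) (pureState φ) = G * Gᴴ := by
    ext ⟨b, e⟩ ⟨b', e'⟩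
    rw [tensorMap_id_apply, h.1, Matrix.mul_apply, Matrix.sum_apply]
    refine Finset.sum_congr rfl fun k _ => ?_
    simp only [Matrix.mul_apply, Matrix.conjTranspose_apply, G, Matrix.of_apply, star_sum,
      Matrix.submatrix_apply, pureState, Matrix.vecMulVec_apply, Pi.star_apply, star_mul',
      Finset.sum_mul, Finset.mul_sum]
    refine Finset.sum_congr rfl fun a _ => Finset.sum_congr rfl fun a' _ => ?_
    ring
  have h2 : complement K ρ = Gᴴ * G := by
    ext k l
    simp only [complement, LinearMap.coe_mk, AddHom.coe_mk, Matrix.of_apply, Matrix.trace,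
      Matrix.diag_apply, Matrix.mul_apply, Matrix.conjTranspose_apply, G, Fintype.sum_prod_type,
      star_sum, star_mul', ← hφ _ _, pureState, Matrix.vecMulVec_apply,
      Pi.star_apply, Finset.sum_mul, Finset.mul_sum]
    refine Finset.sum_congr rfl fun b _ => ?_
    rw [Finset.sum_comm]
    conv_rhs => rw [Finset.sum_comm]
    refine Finset.sum_congr rfl fun a _ => ?_
    conv_rhs => rw [Finset.sum_comm]
    refine Finset.sum_congr rfl fun a' _ => Finset.sum_congr rfl fun e _ => ?_
    ring
  rw [h1, h2, entropy_mul_conjTranspose_comm]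

/-- The two marginals of a pure state have the same entropy. -/
theorem entropy_traceLeft_pureState {φ : A × E → ℂ} {ρ : Matrix A A ℂ}
    (hφ : IsPurification φ ρ) : entropy (traceLeft (pureState φ)) = entropy ρ := by
  let M : Matrix A E ℂ := Matrix.of fun a e => φ (a, e)
  have h1 : ρ = M * Mᴴ := by
    ext a a'
    rw [← hφ]
    simp [pureState, Matrix.vecMulVec_apply, Matrix.mul_apply, M]
  have h2 : traceLeft (pureState φ) = (Mᴴ * M)ᵀ := by
    ext e e'
    simp [traceLeft_apply, pureState, Matrix.vecMulVec_apply, Matrix.mul_apply, M, mul_comm]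
  rw [h1, h2, entropy_transpose (Matrix.isHermitian_conjTranspose_mul_self M),
    entropy_mul_conjTranspose_comm]

theorem exists_purification {ρ : Matrix A A ℂ} (hρ : ρ.PosSemidef) :
    ∃ φ : A × Fin (Fintype.card A) → ℂ, IsPurification φ ρ := by
  obtain ⟨U, d, -, -, hU, hd, -⟩ := exists_conj_diagonal hρ.isHermitian
  have hd := hd hρ
  -- The vector `∑_k √d_k u_k ⊗ k` built from an eigenbasis `u` of `ρ`.
  refine ⟨fun x => U x.1 ((Fintype.equivFin A).symm x.2) *
    (Real.sqrt (d ((Fintype.equivFin A).symm x.2)) : ℂ), fun a a' => ?_⟩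
  rw [hU, Matrix.mul_apply, ← (Fintype.equivFin A).symm.sum_comp]
  refine Finset.sum_congr rfl fun k _ => ?_
  have hsq : (d ((Fintype.equivFin A).symm k) : ℂ) =
      (Real.sqrt (d ((Fintype.equivFin A).symm k)) : ℂ) *
        (Real.sqrt (d ((Fintype.equivFin A).symm k)) : ℂ) := by
    rw [← Complex.ofReal_mul, Real.mul_self_sqrt (hd _)]
  rw [Matrix.mul_diagonal, hsq]
  simp [pureState, Matrix.vecMulVec_apply]
  ring

end Channels

/-! ### Compactness and attainment of the assisted capacity -/

/-- In a finite-dimensional space the convex hull of a compact set is compact. -/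
theorem isCompact_convexHull {V : Type*} [AddCommGroup V] [Module ℝ V] [TopologicalSpace V]
    [ContinuousAdd V] [ContinuousSMul ℝ V] [FiniteDimensional ℝ V] {s : Set V}
    (hs : IsCompact s) : IsCompact (convexHull ℝ s) := by
  -- Carathéodory: at most `finrank + 1` affinely independent points are needed, so `n` runs below
  -- `finrank + 2`.
  have h : convexHull ℝ s = ⋃ n ∈ Finset.range (Module.finrank ℝ V + 2),
      (fun x : (Fin n → ℝ) × (Fin n → V) => ∑ i, x.1 i • x.2 i) ''
        (stdSimplex ℝ (Fin n) ×ˢ Set.pi Set.univ fun _ => s) := by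
    ext x
    simp only [Set.mem_iUnion, Finset.mem_range, Set.mem_image, Prod.exists, Set.mem_prod,
      Set.mem_pi, Set.mem_univ, true_imp_iff]
    constructor
    · intro hx
      obtain ⟨ι, _, z, w, hz, hind, hw, hw1, rfl⟩ := eq_pos_convex_span_of_mem_convexHull hx
      have hcard := hind.card_le_finrank_succ
      have hle := Submodule.finrank_le (vectorSpan ℝ (Set.range z))
      let e := (Fintype.equivFin ι).symm
      refine ⟨Fintype.card ι, by omega, w ∘ e, z ∘ e, ⟨⟨fun i => (hw _).le, ?_⟩, fun i =>
        hz (Set.mem_range_self _)⟩, e.sum_comp fun i => w i • z i⟩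
      exact (e.sum_comp w).trans hw1
    · rintro ⟨n, -, w, z, ⟨⟨hw, hw1⟩, hz⟩, rfl⟩
      exact (convex_convexHull ℝ s).sum_mem (fun i _ => hw i) hw1
        fun i _ => subset_convexHull ℝ s (hz i)
  rw [h]
  refine (Finset.range _).isCompact_biUnion fun n _ => IsCompact.image ?_ (by fun_prop)
  exact (isCompact_stdSimplex ℝ (Fin n)).prod (isCompact_univ_pi fun _ => hs)

section Attained

variable {A B κ : Type*} [Fintype A] [DecidableEq A] [Fintype B] [DecidableEq B]
  [Fintype κ] [DecidableEq κ]

/-- The states are the image of the Hilbert–Schmidt unit sphere under `M ↦ M M*`. -/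
theorem isCompact_setOf_isState : IsCompact {ρ : Matrix A A ℂ | IsState ρ} := by
  have hS : IsCompact {M : Matrix A A ℂ | ∑ i, ∑ j, Complex.normSq (M i j) = 1} := by
    have hb : IsCompact (Set.pi Set.univ fun _ : A => Set.pi Set.univ fun _ : A =>
        Metric.closedBall (0 : ℂ) 1) :=
      isCompact_univ_pi fun _ => isCompact_univ_pi fun _ => isCompact_closedBall 0 1
    refine hb.of_isClosed_subset ?_ ?_
    · refine isClosed_eq (continuous_finsetSum _ fun i _ => continuous_finsetSum _ fun j _ => ?_)
        continuous_const
      exact Complex.continuous_normSq.comp (continuous_apply_apply i j)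
    · intro M hM i _ j _
      rw [mem_closedBall_zero_iff, ← sq_le_one_iff₀ (norm_nonneg _), ← Complex.normSq_eq_norm_sq,
        ← hM.out]
      refine le_trans (Finset.single_le_sum (f := fun j => Complex.normSq (M i j))
        (fun j _ => Complex.normSq_nonneg _) (Finset.mem_univ j)) ?_
      exact Finset.single_le_sum (f := fun i => ∑ j, Complex.normSq (M i j))
        (fun i _ => Finset.sum_nonneg fun j _ => Complex.normSq_nonneg _) (Finset.mem_univ i)
  have htr : ∀ M : Matrix A A ℂ,
      (M * Mᴴ).trace = ((∑ i, ∑ j, Complex.normSq (M i j) : ℝ) : ℂ) := by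
    intro M
    simp [Matrix.trace, Matrix.mul_apply, Complex.mul_conj]
  have himg : {ρ : Matrix A A ℂ | IsState ρ} = (fun M : Matrix A A ℂ => M * Mᴴ) ''
      {M | ∑ i, ∑ j, Complex.normSq (M i j) = 1} := by
    ext ρ
    constructor
    · rintro ⟨h1, h2⟩
      obtain ⟨U, d, -, -, hU, hd, -⟩ := exists_conj_diagonal h1.isHermitian
      have hd := hd h1
      have hM : ρ = (U * Matrix.diagonal fun i => (Real.sqrt (d i) : ℂ)) *
          (U * Matrix.diagonal fun i => (Real.sqrt (d i) : ℂ))ᴴ := by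
        rw [Matrix.conjTranspose_mul, Matrix.diagonal_conjTranspose, ← Matrix.mul_assoc,
          Matrix.mul_assoc U, Matrix.diagonal_mul_diagonal, hU]
        congr 3
        ext i
        simp [← Complex.ofReal_mul, Real.mul_self_sqrt (hd i)]
      refine ⟨_, ?_, hM.symm⟩
      rw [hM, htr] at h2
      exact_mod_cast h2
    · rintro ⟨M, hM, rfl⟩
      refine ⟨Matrix.posSemidef_self_mul_conjTranspose M, ?_⟩
      rw [htr, hM.out, Complex.ofReal_one]
  rw [himg]
  exact hS.image (by fun_prop)

theorem isState_pureState {φ : A → ℂ} (hφ : star φ ⬝ᵥ φ = 1) : IsState (pureState φ) := by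
  refine ⟨Matrix.posSemidef_vecMulVec_self_star φ, ?_⟩
  rw [pureState, Matrix.trace_vecMulVec, dotProduct_comm, hφ]

theorem entropy_pureState {φ : A → ℂ} (hφ : star φ ⬝ᵥ φ = 1) : entropy (pureState φ) = 0 := by
  let M : Matrix A Unit ℂ := Matrix.of fun a _ => φ a
  have h1 : pureState φ = M * Mᴴ := by
    ext a a'
    simp [pureState, Matrix.vecMulVec_apply, Matrix.mul_apply, M]
  have h2 : Mᴴ * M = 1 := by
    ext a a'
    simpa [Matrix.mul_apply, M, dotProduct] using hφ
  have h3 := entropy_conj_diagonal (U := (1 : Matrix Unit Unit ℂ)) (by simp) fun _ => 1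
  rw [h1, entropy_mul_conjTranspose_comm, h2]
  simpa using h3

variable {Φ : Matrix A A ℂ →ₗ[ℂ] Matrix B B ℂ} {K : κ → Matrix B A ℂ}

/-- The difference `S(ρ) - S_e(ρ)` of the input entropy and the entropy exchange, written with the
complementary channel. -/
def entropyGain (K : κ → Matrix B A ℂ) (ρ : Matrix A A ℂ) : ℝ :=
  entropy ρ - entropy (complement K ρ)

/-- By `entropy_exchange` the rate does not depend on the purifications; this lemma and the next
trade them for the complementary channel. -/
theorem HasKraus.exists_ensemble (h : HasKraus Φ K) {P r : ℝ} (hr : r ∈ assistedRates Φ P) :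
    ∃ (m : ℕ) (p : Fin m → ℝ) (ρ : Fin m → Matrix A A ℂ), IsEnsemble p ρ ∧
      ∑ i, p i * entropy (ρ i) ≤ P ∧
      r = ∑ i, p i * entropyGain K (ρ i) + entropy (Φ (∑ i, (p i : ℂ) • ρ i)) := by
  obtain ⟨m, p, ρ, d, φ, hE, hφ, hP, rfl⟩ := hr
  refine ⟨m, p, ρ, hE, hP, ?_⟩
  simp only [entropyGain, mul_sub, Finset.sum_sub_distrib, entropy_exchange h (hφ _)]
  ring

theorem HasKraus.mem_assistedRates (h : HasKraus Φ K) {ι : Type*} [Fintype ι] {P : ℝ}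
    {p : ι → ℝ} {ρ : ι → Matrix A A ℂ} (hp : ∀ i, 0 ≤ p i) (hp1 : ∑ i, p i = 1)
    (hρ : ∀ i, IsState (ρ i)) (hP : ∑ i, p i * entropy (ρ i) ≤ P) :
    ∑ i, p i * entropyGain K (ρ i) + entropy (Φ (∑ i, (p i : ℂ) • ρ i)) ∈ assistedRates Φ P := by
  choose φ hφ using fun i => exists_purification (hρ i).1
  let e := (Fintype.equivFin ι).symm
  refine ⟨Fintype.card ι, p ∘ e, ρ ∘ e, Fintype.card A, φ ∘ e, ⟨fun i => hp _, ?_, fun i => hρ _⟩,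
    fun i => hφ _, ?_, ?_⟩
  · exact (e.sum_comp p).trans hp1
  · exact (e.sum_comp fun i => p i * entropy (ρ i)).trans_le hP
  · simp only [Function.comp_apply, fun i => entropy_exchange h (hφ i)]
    rw [e.sum_comp fun i => p i * entropy (ρ i), e.sum_comp fun i => (p i : ℂ) • ρ i,
      e.sum_comp fun i => p i * entropy (complement K (ρ i))]
    simp only [entropyGain, mul_sub, Finset.sum_sub_distrib]
    ring

theorem HasKraus.isHermitian_map (h : HasKraus Φ K) {X : Matrix A A ℂ} (hX : X.IsHermitian) :
    (Φ X).IsHermitian := by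
  rw [h.1, Matrix.IsHermitian, Matrix.conjTranspose_sum]
  exact Finset.sum_congr rfl fun k _ => Matrix.isHermitian_mul_mul_conjTranspose (K k) hX

/-- The maximum in the definition of the assisted capacity is attained. -/
theorem HasKraus.isGreatest_assistedRates [Nonempty A] (h : HasKraus Φ K) {P : ℝ} (hP : 0 ≤ P) :
    IsGreatest (assistedRates Φ P) (assistedOneShotCapacity Φ P) := by
  -- Constraint and objective depend on an ensemble only through the average of `f`. These averages
  -- fill the convex hull of the compact set of values of `f`, which leaves a continuous function on
  -- a compact set.
  let f : Matrix A A ℂ → Matrix A A ℂ × ℝ × ℝ := fun ρ => (ρ, entropy ρ, entropyGain K ρ)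
  have hherm : {ρ : Matrix A A ℂ | IsState ρ} ⊆ {ρ | ρ.IsHermitian} := fun ρ hρ => hρ.1.isHermitian
  have hS : ContinuousOn (entropy : Matrix A A ℂ → ℝ) {ρ | IsState ρ} :=
    continuousOn_entropy.mono hherm
  have hSe : ContinuousOn (fun ρ : Matrix A A ℂ => entropy (complement K ρ)) {ρ | IsState ρ} :=
    continuousOn_entropy.comp (complement K).continuous_of_finiteDimensional.continuousOn
      fun ρ hρ => isHermitian_complement K (hherm hρ)
  have hf : ContinuousOn f {ρ | IsState ρ} := continuousOn_id.prodMk (hS.prodMk (hS.sub hSe))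
  have hK := isCompact_convexHull (isCompact_setOf_isState.image_of_continuousOn hf)
  set H := convexHull ℝ (f '' {ρ | IsState ρ}) with hH
  have hHh : H ⊆ {x | x.1.IsHermitian} := by
    refine convexHull_min ?_ ?_
    · rintro _ ⟨ρ, hρ, rfl⟩
      exact hherm hρ
    · intro x hx y hy a b _ _ _
      refine Matrix.IsHermitian.add ?_ ?_
      · exact (IsSelfAdjoint.smul (IsSelfAdjoint.all a) hx : IsSelfAdjoint (a • x.1))
      · exact (IsSelfAdjoint.smul (IsSelfAdjoint.all b) hy : IsSelfAdjoint (b • y.1))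
  have hT : IsCompact (H ∩ {x | x.2.1 ≤ P}) :=
    hK.inter_right (isClosed_le (by fun_prop) continuous_const)
  -- A single pure state has entropy zero, hence is admissible for every `P ≥ 0`.
  have hne : (H ∩ {x | x.2.1 ≤ P}).Nonempty := by
    obtain ⟨a⟩ := ‹Nonempty A›
    have ha : star (Pi.single a 1 : A → ℂ) ⬝ᵥ Pi.single a 1 = 1 := by simp
    refine ⟨f (pureState (Pi.single a 1)),
      subset_convexHull ℝ _ ⟨_, isState_pureState ha, rfl⟩, ?_⟩
    simpa [f, entropy_pureState ha] using hP
  have hg : ContinuousOn (fun x : Matrix A A ℂ × ℝ × ℝ => x.2.2 + entropy (Φ x.1))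
      (H ∩ {x | x.2.1 ≤ P}) := by
    refine ContinuousOn.add (by fun_prop) (continuousOn_entropy.comp
      (Φ.continuous_of_finiteDimensional.comp continuous_fst).continuousOn fun x hx => ?_)
    exact h.isHermitian_map (hHh hx.1)
  obtain ⟨x, hx, hmax⟩ := hT.exists_isMaxOn hne hg
  have hG : IsGreatest (assistedRates Φ P) (x.2.2 + entropy (Φ x.1)) := by
    constructor
    · obtain ⟨ι, _, w, z, hw, hw1, hz, hxz⟩ := mem_convexHull_iff_exists_fintype.1 hx.1
      choose ρ hρ hfz using hz
      have h1 : x.1 = ∑ i, (w i : ℂ) • ρ i := by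
        rw [← hxz, Prod.fst_sum]
        refine Finset.sum_congr rfl fun i _ => ?_
        rw [← hfz i]
        rfl
      have h2 : x.2.1 = ∑ i, w i * entropy (ρ i) := by
        rw [← hxz, Prod.snd_sum, Prod.fst_sum]
        refine Finset.sum_congr rfl fun i _ => ?_
        rw [← hfz i]
        rfl
      have h3 : x.2.2 = ∑ i, w i * entropyGain K (ρ i) := by
        rw [← hxz, Prod.snd_sum, Prod.snd_sum]
        refine Finset.sum_congr rfl fun i _ => ?_
        rw [← hfz i]
        rfl
      rw [h1, h3]
      exact h.mem_assistedRates hw hw1 hρ (h2 ▸ hx.2)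
    · intro r hr
      obtain ⟨m, p, ρ, ⟨hp, hp1, hρ⟩, hPr, rfl⟩ := h.exists_ensemble hr
      have hmem : ∑ i, p i • f (ρ i) ∈ H :=
        (convex_convexHull ℝ _).sum_mem (fun i _ => hp i) hp1
          fun i _ => subset_convexHull ℝ _ ⟨_, hρ i, rfl⟩
      have hval : ∑ i, p i • f (ρ i) = (∑ i, (p i : ℂ) • ρ i, ∑ i, p i * entropy (ρ i),
          ∑ i, p i * entropyGain K (ρ i)) := by
        refine Prod.ext ?_ (Prod.ext ?_ ?_)
        · rw [Prod.fst_sum]; rfl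
        · rw [Prod.snd_sum, Prod.fst_sum]; rfl
        · rw [Prod.snd_sum, Prod.snd_sum]; rfl
      rw [hval] at hmem
      exact hmax ⟨hmem, hPr⟩
  rw [assistedOneShotCapacity, hG.csSup_eq]
  exact hG

end Attained

/-! ### Shannon theory of a transition matrix -/

section Shannon

variable {A B : Type*} [Fintype A] [DecidableEq A] [Fintype B] [DecidableEq B]

/-- The Shannon entropy in bits. -/
def shannon (p : B → ℝ) : ℝ := ∑ b, eta (p b)

/-- The output distribution of a classical channel with transition probabilities `W`. -/
def outputDist (W : A → B → ℝ) (q : A → ℝ) (y : B) : ℝ := ∑ x, q x * W x y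

/-- The mutual information between the input and the output of a classical channel. -/
def classicalRate (W : A → B → ℝ) (q : A → ℝ) : ℝ :=
  shannon (outputDist W q) - ∑ x, q x * shannon (W x)

theorem continuous_shannon : Continuous (shannon : (B → ℝ) → ℝ) :=
  continuous_finsetSum _ fun b _ => continuous_eta.comp (continuous_apply b)

theorem exists_isMaxOn_classicalRate [Nonempty A] (W : A → B → ℝ) :
    ∃ q ∈ stdSimplex ℝ A, IsMaxOn (classicalRate W) (stdSimplex ℝ A) q := by
  obtain ⟨a⟩ := ‹Nonempty A›
  refine (isCompact_stdSimplex ℝ A).exists_isMaxOn ⟨_, single_mem_stdSimplex ℝ a⟩ ?_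
  refine Continuous.continuousOn (Continuous.sub (continuous_shannon.comp ?_) (by fun_prop))
  exact continuous_pi fun y => by unfold outputDist; fun_prop

theorem concaveOn_eta : ConcaveOn ℝ (Set.Ici 0) eta := by
  have h := Real.concaveOn_negMulLog.smul (c := (Real.log 2)⁻¹)
    (inv_nonneg.2 (Real.log_nonneg (by norm_num)))
  refine h.congr fun x _ => ?_
  simp only [smul_eq_mul, eta]
  ring

theorem outputDist_mem {W : A → B → ℝ} (hW : ∀ x, W x ∈ stdSimplex ℝ B) {q : A → ℝ}
    (hq : q ∈ stdSimplex ℝ A) : outputDist W q ∈ stdSimplex ℝ B := by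
  refine ⟨fun y => Finset.sum_nonneg fun x _ => mul_nonneg (hq.1 x) ((hW x).1 y), ?_⟩
  simp only [outputDist]
  rw [Finset.sum_comm]
  simp only [← Finset.mul_sum, (hW _).2, mul_one, hq.2]

/-- Concavity of the Shannon entropy. -/
theorem sum_mul_shannon_le {W : A → B → ℝ} (hW : ∀ x, W x ∈ stdSimplex ℝ B) {q : A → ℝ}
    (hq : q ∈ stdSimplex ℝ A) : ∑ x, q x * shannon (W x) ≤ shannon (outputDist W q) := by
  simp only [shannon, Finset.mul_sum, outputDist]
  rw [Finset.sum_comm]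
  refine Finset.sum_le_sum fun y _ => ?_
  have := concaveOn_eta.le_map_sum (t := Finset.univ) (w := q) (p := fun x => W x y)
    (fun x _ => hq.1 x) hq.2 fun x _ => (hW x).1 y
  simpa using this

/-- Leibniz rule for the derivation-like identity `eta_mul`. Each summand is written as a product
over all coordinates so that its sum over strings factorizes. -/
theorem eta_prod {ι : Type*} [DecidableEq ι] (s : Finset ι) (x : ι → ℝ) :
    eta (∏ t ∈ s, x t) = ∑ t ∈ s, ∏ u ∈ s, if u = t then eta (x u) else x u := by
  induction s using Finset.induction_on with
  | empty => simp
  | insert a s ha ih =>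
    rw [Finset.prod_insert ha, eta_mul, ih, Finset.sum_insert ha, Finset.prod_insert ha,
      if_pos rfl, Finset.mul_sum, mul_comm (∏ t ∈ s, x t)]
    congr 1
    · congr 1
      refine Finset.prod_congr rfl fun u hu => ?_
      rw [if_neg fun h : u = a => ha (h ▸ hu)]
    · refine Finset.sum_congr rfl fun t ht => ?_
      rw [Finset.prod_insert ha, if_neg fun h : a = t => ha (h ▸ ht)]

/-- The Shannon entropy of a product distribution. -/
theorem shannon_prod {n : ℕ} {s : Fin n → B → ℝ} (hs : ∀ t, ∑ b, s t b = 1) :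
    shannon (fun y : Fin n → B => ∏ t, s t (y t)) = ∑ t, shannon (s t) := by
  simp only [shannon, eta_prod]
  rw [Finset.sum_comm]
  refine Finset.sum_congr rfl fun t _ => ?_
  rw [← Fintype.prod_sum fun u b => if u = t then eta (s u b) else s u b,
    ← Finset.mul_prod_erase _ _ (Finset.mem_univ t), Finset.prod_eq_one, mul_one]
  · simp
  · intro u hu
    simp [Finset.ne_of_mem_erase hu, hs]

/-- The marginal distribution of the coordinate `t`. -/
def marginal {n : ℕ} (r : (Fin n → B) → ℝ) (t : Fin n) (b : B) : ℝ :=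
  ∑ y, if y t = b then r y else 0

theorem sum_marginal_mul {n : ℕ} (r : (Fin n → B) → ℝ) (t : Fin n) (g : B → ℝ) :
    ∑ b, marginal r t b * g b = ∑ y, r y * g (y t) := by
  simp only [marginal, Finset.sum_mul]
  rw [Finset.sum_comm]
  exact Finset.sum_congr rfl fun y _ => by simp

theorem marginal_mem {n : ℕ} {r : (Fin n → B) → ℝ} (hr : r ∈ stdSimplex ℝ (Fin n → B))
    (t : Fin n) : marginal r t ∈ stdSimplex ℝ B := by
  refine ⟨fun b => Finset.sum_nonneg fun y _ => ?_, ?_⟩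
  · split_ifs
    exacts [hr.1 y, le_rfl]
  · simpa [hr.2] using sum_marginal_mul r t fun _ => 1

/-- Gibbs' inequality. -/
theorem sum_mul_log_le {p s : B → ℝ} (hp : ∀ b, 0 ≤ p b) (hs : ∀ b, 0 ≤ s b)
    (hsum : ∑ b, s b = ∑ b, p b) (hps : ∀ b, s b = 0 → p b = 0) :
    ∑ b, p b * Real.log (s b) ≤ ∑ b, p b * Real.log (p b) := by
  have h : ∑ b, (p b * Real.log (s b) - p b * Real.log (p b)) ≤ ∑ b, (s b - p b) := by
    refine Finset.sum_le_sum fun b _ => ?_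
    rcases (hp b).eq_or_lt with h0 | h0
    · simp [← h0, hs b]
    · have hsb : 0 < s b := (hs b).lt_of_ne fun h => h0.ne' (hps b h.symm)
      have h1 := mul_le_mul_of_nonneg_left (Real.log_le_sub_one_of_pos (div_pos hsb h0)) h0.le
      rw [Real.log_div hsb.ne' h0.ne', mul_sub, mul_sub, mul_div_cancel₀ _ h0.ne'] at h1
      linarith
  rw [Finset.sum_sub_distrib, Finset.sum_sub_distrib, hsum] at h
  linarith

theorem sum_mul_log_eq (p : B → ℝ) :
    ∑ b, p b * Real.log (p b) = -(Real.log 2 * shannon p) := by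
  rw [shannon, Finset.mul_sum, ← Finset.sum_neg_distrib]
  refine Finset.sum_congr rfl fun b _ => ?_
  have : Real.log 2 ≠ 0 := (Real.log_pos (by norm_num)).ne'
  rw [eta, Real.negMulLog]
  field_simp

/-- Subadditivity of the Shannon entropy. -/
theorem shannon_le_sum_marginal {n : ℕ} {r : (Fin n → B) → ℝ}
    (hr : r ∈ stdSimplex ℝ (Fin n → B)) : shannon r ≤ ∑ t, shannon (marginal r t) := by
  have hlog : 0 < Real.log 2 := Real.log_pos (by norm_num)
  have hm := fun t => marginal_mem hr t
  have hz : ∀ y, ∏ t, marginal r t (y t) = 0 → r y = 0 := by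
    intro y hy
    obtain ⟨t, -, ht⟩ := Finset.prod_eq_zero_iff.1 hy
    rw [marginal, Finset.sum_eq_zero_iff_of_nonneg
      fun y _ => by split_ifs; exacts [hr.1 y, le_rfl]] at ht
    simpa using ht y (Finset.mem_univ y)
  have hsum : ∑ y : Fin n → B, ∏ t, marginal r t (y t) = ∑ y, r y := by
    rw [← Fintype.prod_sum fun t b => marginal r t b, hr.2]
    exact Finset.prod_eq_one fun t _ => (hm t).2
  -- Gibbs' inequality against the product of the marginals; `hz` supplies the absolute continuity.
  have hG := sum_mul_log_le hr.1 (fun y => Finset.prod_nonneg fun t _ => (hm t).1 (y t)) hsum hz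
  have hE : ∑ y, r y * Real.log (∏ t, marginal r t (y t)) =
      ∑ t, ∑ b, marginal r t b * Real.log (marginal r t b) := by
    simp only [sum_marginal_mul]
    rw [Finset.sum_comm]
    refine Finset.sum_congr rfl fun y _ => ?_
    rw [← Finset.mul_sum]
    by_cases hy : r y = 0
    · simp [hy]
    · rw [Real.log_prod fun t _ h => hy (hz y (Finset.prod_eq_zero (Finset.mem_univ t) h))]
  simp only [hE, sum_mul_log_eq, Finset.sum_neg_distrib, ← Finset.mul_sum] at hG
  exact le_of_mul_le_mul_left (by linarith) hlog

/-- The transition probabilities of `n` independent uses of a classical channel. -/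
def powDist {A : Type*} (W : A → B → ℝ) (n : ℕ) (x : Fin n → A) (y : Fin n → B) : ℝ :=
  ∏ t, W (x t) (y t)

theorem powDist_mem {W : A → B → ℝ} (hW : ∀ x, W x ∈ stdSimplex ℝ B) (n : ℕ) (x : Fin n → A) :
    powDist W n x ∈ stdSimplex ℝ (Fin n → B) := by
  refine ⟨fun y => Finset.prod_nonneg fun t _ => (hW (x t)).1 (y t), ?_⟩
  simp only [powDist]
  rw [← Fintype.prod_sum fun t b => W (x t) b]
  exact Finset.prod_eq_one fun t _ => (hW (x t)).2

theorem marginal_prod {n : ℕ} {s : Fin n → B → ℝ} (hs : ∀ t, ∑ b, s t b = 1) (t : Fin n) :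
    marginal (fun y => ∏ u, s u (y u)) t = s t := by
  ext b
  -- The indicator is moved into the factor at `t`, so that the sum over strings factorizes.
  have h : ∀ y : Fin n → B, (if y t = b then ∏ u, s u (y u) else 0) =
      ∏ u, if u = t then (if y u = b then s u (y u) else 0) else s u (y u) := by
    intro y
    split_ifs with hy
    · refine Finset.prod_congr rfl fun u _ => ?_
      split_ifs with h1 h2
      · rfl
      · exact absurd (h1 ▸ hy) h2
      · rfl
    · exact (Finset.prod_eq_zero (Finset.mem_univ t) (by simp [hy])).symm
  simp only [marginal, h]
  rw [← Fintype.prod_sum fun u c => if u = t then (if c = b then s u c else 0) else s u c,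
    ← Finset.mul_prod_erase _ _ (Finset.mem_univ t), Finset.prod_eq_one, mul_one]
  · simp
  · intro u hu
    simp [Finset.ne_of_mem_erase hu, hs]

/-- Without memory, output `t` depends only on input `t`, whatever the correlations between the
inputs. -/
theorem marginal_outputDist_pow {W : A → B → ℝ} (hW : ∀ x, W x ∈ stdSimplex ℝ B) {n : ℕ}
    (r : (Fin n → A) → ℝ) (t : Fin n) :
    marginal (outputDist (powDist W n) r) t = outputDist W (marginal r t) := by
  ext b
  have h : ∀ x : Fin n → A, marginal (powDist W n x) t b = W (x t) b := fun x =>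
    congrFun (marginal_prod (fun u => (hW (x u)).2) t) b
  rw [outputDist, sum_marginal_mul r t fun a => W a b]
  simp only [← h, marginal, outputDist, Finset.mul_sum]
  rw [Finset.sum_comm]
  refine Finset.sum_congr rfl fun y _ => ?_
  by_cases hy : y t = b <;> simp [hy]

theorem sum_mul_shannon_powDist {W : A → B → ℝ} (hW : ∀ x, W x ∈ stdSimplex ℝ B) {n : ℕ}
    (r : (Fin n → A) → ℝ) :
    ∑ x, r x * shannon (powDist W n x) = ∑ t, ∑ a, marginal r t a * shannon (W a) := by
  simp only [sum_marginal_mul]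
  rw [Finset.sum_comm]
  refine Finset.sum_congr rfl fun x _ => ?_
  rw [← Finset.mul_sum]
  congr 1
  exact shannon_prod fun t => (hW (x t)).2

/-- The output entropy is subadditive, while the conditional entropy is exactly additive because the
output given the input string has a product distribution. -/
theorem classicalRate_powDist_le {W : A → B → ℝ} (hW : ∀ x, W x ∈ stdSimplex ℝ B) {n : ℕ}
    {r : (Fin n → A) → ℝ} (hr : r ∈ stdSimplex ℝ (Fin n → A)) :
    classicalRate (powDist W n) r ≤ ∑ t, classicalRate W (marginal r t) := by
  have h := shannon_le_sum_marginal (outputDist_mem (powDist_mem hW n) hr)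
  simp only [marginal_outputDist_pow hW] at h
  simp only [classicalRate, Finset.sum_sub_distrib, sum_mul_shannon_powDist hW]
  linarith

theorem classicalRate_powDist_prod {W : A → B → ℝ} (hW : ∀ x, W x ∈ stdSimplex ℝ B) (n : ℕ)
    {q : A → ℝ} (hq : q ∈ stdSimplex ℝ A) :
    classicalRate (powDist W n) (fun x => ∏ t, q (x t)) = n * classicalRate W q := by
  have h : outputDist (powDist W n) (fun x => ∏ t, q (x t)) =
      fun y => ∏ t, outputDist W q (y t) := by
    ext y
    simp only [outputDist, powDist, ← Finset.prod_mul_distrib]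
    rw [← Fintype.prod_sum fun t a => q a * W a (y t)]
  rw [classicalRate, sum_mul_shannon_powDist hW, h,
    shannon_prod (s := fun _ => outputDist W q) fun _ => (outputDist_mem hW hq).2]
  simp only [marginal_prod (s := fun _ => q) fun _ => hq.2, Finset.sum_const, Finset.card_univ,
    Fintype.card_fin, nsmul_eq_mul, classicalRate]
  ring

theorem prod_mem_stdSimplex {q : A → ℝ} (hq : q ∈ stdSimplex ℝ A) (n : ℕ) :
    (fun x : Fin n → A => ∏ t, q (x t)) ∈ stdSimplex ℝ (Fin n → A) := by
  refine ⟨fun x => Finset.prod_nonneg fun t _ => hq.1 (x t), ?_⟩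
  rw [← Fintype.prod_sum fun (_ : Fin n) a => q a]
  exact Finset.prod_eq_one fun t _ => hq.2

/-- The mutual information of `n` independent uses is maximized by product distributions. -/
theorem isMaxOn_classicalRate_powDist {W : A → B → ℝ} (hW : ∀ x, W x ∈ stdSimplex ℝ B) (n : ℕ)
    {q : A → ℝ} (hq : q ∈ stdSimplex ℝ A) (hmax : IsMaxOn (classicalRate W) (stdSimplex ℝ A) q) :
    IsMaxOn (classicalRate (powDist W n)) (stdSimplex ℝ (Fin n → A)) fun x => ∏ t, q (x t) := by
  intro r hr
  rw [Set.mem_ofPred_eq, classicalRate_powDist_prod hW n hq]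
  refine (classicalRate_powDist_le hW hr).trans ?_
  refine (Finset.sum_le_sum fun t _ => hmax (marginal_mem hr t)).trans ?_
  simp

end Shannon

/-! ### Classical channels and their capacity -/

section Classical

variable {A B : Type*} [Fintype A] [DecidableEq A] [Fintype B] [DecidableEq B]

/-- A matrix form of a classical channel: `Φ(X) = V diag(∑_x W(·|x) (U* X U)_{xx}) V*` with `U` and
`V` unitary. -/
structure IsClassicalForm (Φ : Matrix A A ℂ →ₗ[ℂ] Matrix B B ℂ) (U : Matrix A A ℂ)
    (V : Matrix B B ℂ) (W : A → B → ℝ) : Prop where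
  star_mul_left : Uᴴ * U = 1
  star_mul_right : Vᴴ * V = 1
  mem_simplex : ∀ x, W x ∈ stdSimplex ℝ B
  apply_eq : ∀ X, Φ X = V *
    Matrix.diagonal (fun y => ∑ x, (Uᴴ * X * U) x x * (W x y : ℂ)) * Vᴴ

theorem conjTranspose_mul_self_of_basis (e : OrthonormalBasis A ℂ (EuclideanSpace ℂ A)) :
    (Matrix.of fun a x => (e x).ofLp a)ᴴ * (Matrix.of fun a x => (e x).ofLp a) = 1 := by
  ext x y
  have h := orthonormal_iff_ite.1 e.orthonormal x y
  rw [EuclideanSpace.inner_eq_star_dotProduct] at h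
  rw [Matrix.one_apply, ← h]
  simp [Matrix.mul_apply, dotProduct, mul_comm]

theorem IsClassicalChannel.exists_form {Φ : Matrix A A ℂ →ₗ[ℂ] Matrix B B ℂ}
    (h : IsClassicalChannel Φ) :
    ∃ (U : Matrix A A ℂ) (V : Matrix B B ℂ) (W : A → B → ℝ), IsClassicalForm Φ U V W := by
  obtain ⟨e, f, W, hW, hW1, hΦ⟩ := h
  refine ⟨_, _, W, conjTranspose_mul_self_of_basis e, conjTranspose_mul_self_of_basis f,
    fun x => ⟨hW x, hW1 x⟩, fun X => ?_⟩
  have hc : ∀ x, star (e x).ofLp ⬝ᵥ X *ᵥ (e x).ofLp = ((Matrix.of fun a x => (e x).ofLp a)ᴴ * X *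
      (Matrix.of fun a x => (e x).ofLp a)) x x := by
    intro x
    rw [Matrix.mul_assoc, Matrix.mul_apply]
    rfl
  rw [hΦ]
  simp only [hc]
  ext b b'
  rw [Finset.sum_comm]
  simp only [Matrix.sum_apply, Matrix.smul_apply, Matrix.vecMulVec_apply, smul_eq_mul,
    Matrix.mul_apply (N := (Matrix.of fun a x => (f x).ofLp a)ᴴ), Matrix.mul_diagonal,
    Matrix.conjTranspose_apply, Matrix.of_apply, Pi.star_apply]
  refine Finset.sum_congr rfl fun y _ => ?_
  rw [Finset.mul_sum, Finset.sum_mul]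
  exact Finset.sum_congr rfl fun x _ => by ring

/-- The distribution of the outcomes of the measurement in the basis of the columns of `U`. -/
def measureDist (U : Matrix A A ℂ) (ρ : Matrix A A ℂ) (x : A) : ℝ := ((Uᴴ * ρ * U) x x).re

variable {U : Matrix A A ℂ} {V : Matrix B B ℂ} {W : A → B → ℝ}
  {Φ : Matrix A A ℂ →ₗ[ℂ] Matrix B B ℂ}

theorem ofReal_measureDist (U : Matrix A A ℂ) {ρ : Matrix A A ℂ} (hρ : ρ.PosSemidef) (x : A) :
    (measureDist U ρ x : ℂ) = (Uᴴ * ρ * U) x x := by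
  have h := (hρ.conjTranspose_mul_mul_same U).diag_nonneg (i := x)
  exact (Complex.eq_re_of_ofReal_le h).symm

theorem measureDist_mem (hU : Uᴴ * U = 1) {ρ : Matrix A A ℂ} (hρ : IsState ρ) :
    measureDist U ρ ∈ stdSimplex ℝ A := by
  constructor
  · intro x
    have h := (hρ.1.conjTranspose_mul_mul_same U).diag_nonneg (i := x)
    exact (Complex.le_def.1 h).1
  · have h : (Uᴴ * ρ * U).trace = 1 := by
      rw [Matrix.trace_mul_cycle, mul_eq_one_comm.1 hU, Matrix.one_mul, hρ.2]
    have h2 := congrArg Complex.re h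
    rw [Matrix.trace, Complex.re_sum, Complex.one_re] at h2
    exact h2

theorem IsClassicalForm.apply_posSemidef (h : IsClassicalForm Φ U V W) {ρ : Matrix A A ℂ}
    (hρ : ρ.PosSemidef) : Φ ρ = V *
      Matrix.diagonal (fun y => (outputDist W (measureDist U ρ) y : ℂ)) * Vᴴ := by
  rw [h.apply_eq]
  congr 3
  ext y
  rw [outputDist, Complex.ofReal_sum]
  refine Finset.sum_congr rfl fun x _ => ?_
  rw [Complex.ofReal_mul, ofReal_measureDist U hρ]

theorem IsClassicalForm.entropy_apply (h : IsClassicalForm Φ U V W) {ρ : Matrix A A ℂ}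
    (hρ : ρ.PosSemidef) : entropy (Φ ρ) = shannon (outputDist W (measureDist U ρ)) := by
  rw [h.apply_posSemidef hρ, entropy_conj_diagonal h.star_mul_right]
  rfl

theorem isState_sum {ι : Type*} [Fintype ι] {p : ι → ℝ} {ρ : ι → Matrix A A ℂ}
    (hp : ∀ i, 0 ≤ p i) (hp1 : ∑ i, p i = 1) (hρ : ∀ i, IsState (ρ i)) :
    IsState (∑ i, (p i : ℂ) • ρ i) := by
  refine ⟨Matrix.posSemidef_sum _ fun i _ => (hρ i).1.smul (by exact_mod_cast hp i), ?_⟩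
  rw [Matrix.trace_sum]
  simp only [Matrix.trace_smul, (hρ _).2, smul_eq_mul, mul_one]
  exact_mod_cast hp1

theorem measureDist_sum {ι : Type*} [Fintype ι] (p : ι → ℝ) (ρ : ι → Matrix A A ℂ) (x : A) :
    measureDist U (∑ i, (p i : ℂ) • ρ i) x = ∑ i, p i * measureDist U (ρ i) x := by
  rw [measureDist, Matrix.mul_sum, Matrix.sum_mul, Matrix.sum_apply, Complex.re_sum]
  refine Finset.sum_congr rfl fun i _ => ?_
  simp [measureDist]

/-- The basis state that is perfectly distinguished by the measurement in the basis `U`. -/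
def basisState (U : Matrix A A ℂ) (x : A) : Matrix A A ℂ := pureState fun a => U a x

theorem star_dotProduct_col (hU : Uᴴ * U = 1) (x : A) :
    star (fun a => U a x) ⬝ᵥ (fun a => U a x) = 1 := by
  have := congrFun (congrFun hU x) x
  rw [Matrix.one_apply_eq] at this
  exact this

theorem isState_basisState (hU : Uᴴ * U = 1) (x : A) : IsState (basisState U x) :=
  isState_pureState (star_dotProduct_col hU x)

theorem conj_basisState (hU : Uᴴ * U = 1) (x : A) :
    Uᴴ * basisState U x * U = Matrix.single x x 1 := by
  have h : basisState U x = U * Matrix.single x x (1 : ℂ) * Uᴴ := by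
    ext a a'
    simp [basisState, pureState, Matrix.vecMulVec_apply, Matrix.mul_apply, Matrix.single_apply,
      ite_and]
  rw [h, Matrix.mul_assoc, Matrix.mul_assoc, Matrix.mul_assoc, hU, Matrix.mul_one,
    ← Matrix.mul_assoc, hU, Matrix.one_mul]

theorem measureDist_basisState (hU : Uᴴ * U = 1) (x : A) :
    measureDist U (basisState U x) = Pi.single x 1 := by
  ext y
  rw [measureDist, conj_basisState hU, Matrix.single_apply, Pi.single_apply]
  by_cases h : x = y
  · simp [h]
  · simp [h, Ne.symm h]

theorem IsClassicalForm.entropy_basisState (h : IsClassicalForm Φ U V W) (x : A) :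
    entropy (Φ (basisState U x)) = shannon (W x) := by
  rw [h.entropy_apply (isState_basisState h.star_mul_left x).1,
    measureDist_basisState h.star_mul_left]
  congr 1
  ext y
  simp [outputDist, Pi.single_apply]

/-- Averages of the basis states. -/
theorem IsClassicalForm.entropy_average (h : IsClassicalForm Φ U V W) {q : A → ℝ}
    (hq : q ∈ stdSimplex ℝ A) :
    entropy (Φ (∑ x, (q x : ℂ) • basisState U x)) = shannon (outputDist W q) := by
  rw [h.entropy_apply (isState_sum hq.1 hq.2 fun x => isState_basisState h.star_mul_left x).1]
  congr 2
  ext x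
  rw [measureDist_sum]
  simp [measureDist_basisState h.star_mul_left, Pi.single_apply]

/-- Basis states reproduce the mutual information of `W`. Conversely, replacing an input by the
basis states it is measured into keeps the average output and, by concavity of the Shannon entropy,
cannot raise the average output entropy. -/
theorem IsClassicalForm.isGreatest_holevoRates (h : IsClassicalForm Φ U V W) {q : A → ℝ}
    (hq : q ∈ stdSimplex ℝ A) (hmax : IsMaxOn (classicalRate W) (stdSimplex ℝ A) q) :
    IsGreatest (holevoRates Φ) (classicalRate W q) := by
  constructor
  · let e := (Fintype.equivFin A).symm
    refine ⟨Fintype.card A, q ∘ e, basisState U ∘ e, ⟨fun i => hq.1 _, ?_,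
      fun i => isState_basisState h.star_mul_left _⟩, ?_⟩
    · exact (e.sum_comp q).trans hq.2
    · simp only [Function.comp_apply, ← map_smul, ← map_sum]
      rw [e.sum_comp fun x => (q x : ℂ) • basisState U x,
        e.sum_comp fun x => q x * entropy (Φ (basisState U x)), h.entropy_average hq]
      simp only [h.entropy_basisState, classicalRate]
  · rintro r ⟨m, p, ρ, ⟨hp, hp1, hρ⟩, rfl⟩
    simp only [← map_smul, ← map_sum]
    have hst := isState_sum hp hp1 hρ
    refine le_trans ?_ (hmax (measureDist_mem h.star_mul_left hst))
    rw [h.entropy_apply hst.1, classicalRate]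
    refine sub_le_sub_left ?_ _
    have h1 : ∑ x, measureDist U (∑ i, (p i : ℂ) • ρ i) x * shannon (W x) =
        ∑ i, p i * ∑ x, measureDist U (ρ i) x * shannon (W x) := by
      simp only [measureDist_sum, Finset.sum_mul, Finset.mul_sum, mul_assoc]
      rw [Finset.sum_comm]
    rw [h1]
    refine Finset.sum_le_sum fun i _ => mul_le_mul_of_nonneg_left ?_ (hp i)
    rw [h.entropy_apply (hρ i).1]
    exact sum_mul_shannon_le h.mem_simplex (measureDist_mem h.star_mul_left (hρ i))

/-- The `n`-fold tensor power of a matrix. -/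
def matrixPow {A B : Type*} (M : Matrix A B ℂ) (n : ℕ) : Matrix (Fin n → A) (Fin n → B) ℂ :=
  Matrix.of fun a b => ∏ t, M (a t) (b t)

theorem matrixPow_star_mul (hU : Uᴴ * U = 1) (n : ℕ) :
    (matrixPow U n)ᴴ * matrixPow U n = 1 := by
  ext x y
  have h : ∀ t, ∑ a, star (U a (x t)) * U a (y t) = if x t = y t then 1 else 0 := fun t => by
    rw [← Matrix.one_apply, ← hU]; rfl
  simp only [Matrix.mul_apply, Matrix.conjTranspose_apply, matrixPow, Matrix.of_apply, star_prod,
    ← Finset.prod_mul_distrib]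
  rw [← Fintype.prod_sum fun t a => star (U a (x t)) * U a (y t)]
  simp only [h, Matrix.one_apply]
  by_cases hxy : x = y
  · simp [hxy]
  · obtain ⟨t, ht⟩ := Function.ne_iff.1 hxy
    rw [if_neg hxy]
    exact Finset.prod_eq_zero (Finset.mem_univ t) (if_neg ht)

/-- Tensor powers of classical channels are classical. -/
theorem IsClassicalForm.tensorPow (h : IsClassicalForm Φ U V W) (n : ℕ) :
    IsClassicalForm (tensorPow Φ n) (matrixPow U n) (matrixPow V n) (powDist W n) where
  star_mul_left := matrixPow_star_mul h.star_mul_left n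
  star_mul_right := matrixPow_star_mul h.star_mul_right n
  mem_simplex := powDist_mem h.mem_simplex n
  apply_eq X := by
    have hs : ∀ (i j : A) (b b' : B), Φ (Matrix.single i j 1) b b' =
        ∑ y, ∑ x, V b y * (star (U i x) * U j x * (W x y : ℂ)) * star (V b' y) := by
      intro i j b b'
      rw [h.apply_eq, Matrix.mul_apply]
      refine Finset.sum_congr rfl fun y _ => ?_
      rw [Matrix.mul_diagonal, Finset.mul_sum, Finset.sum_mul]
      refine Finset.sum_congr rfl fun x _ => ?_
      simp [Matrix.mul_apply, Matrix.single_apply, ite_and]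
    ext b b'
    simp only [QShannon.tensorPow, LinearMap.coe_mk, AddHom.coe_mk, Matrix.sum_apply,
      Matrix.smul_apply, Matrix.of_apply, hs, smul_eq_mul]
    rw [Matrix.mul_apply]
    have hL : ∀ i j : Fin n → A, ∏ t, ∑ y, ∑ x, V (b t) y *
        (star (U (i t) x) * U (j t) x * (W x y : ℂ)) * star (V (b' t) y) =
        ∑ y, ∑ x, matrixPow V n b y * (star (matrixPow U n i x) * matrixPow U n j x *
          (powDist W n x y : ℂ)) * star (matrixPow V n b' y) := by
      intro i j
      rw [Fintype.prod_sum]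
      refine Finset.sum_congr rfl fun y _ => ?_
      rw [Fintype.prod_sum]
      refine Finset.sum_congr rfl fun x _ => ?_
      simp only [Finset.prod_mul_distrib, matrixPow, Matrix.of_apply, powDist, star_prod,
        Complex.ofReal_prod]
    have hR : ∀ x, ((matrixPow U n)ᴴ * X * matrixPow U n) x x =
        ∑ i, ∑ j, X i j * (star (matrixPow U n i x) * matrixPow U n j x) := by
      intro x
      rw [Matrix.mul_apply, Finset.sum_comm]
      refine Finset.sum_congr rfl fun j _ => ?_
      rw [Matrix.mul_apply, Finset.sum_mul]
      refine Finset.sum_congr rfl fun i _ => ?_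
      rw [Matrix.conjTranspose_apply]
      ring
    simp only [hL, hR, Matrix.mul_diagonal, Matrix.conjTranspose_apply, Finset.mul_sum,
      Finset.sum_mul]
    rw [Finset.sum_congr rfl fun i _ => Finset.sum_comm, Finset.sum_comm]
    refine Finset.sum_congr rfl fun y _ => ?_
    rw [Finset.sum_congr rfl fun i _ => Finset.sum_comm, Finset.sum_comm]
    refine Finset.sum_congr rfl fun x _ => Finset.sum_congr rfl fun i _ =>
      Finset.sum_congr rfl fun j _ => ?_
    ring

theorem IsClassicalForm.isGreatest_tensorPow (h : IsClassicalForm Φ U V W) {q : A → ℝ}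
    (hq : q ∈ stdSimplex ℝ A) (hmax : IsMaxOn (classicalRate W) (stdSimplex ℝ A) q) (n : ℕ) :
    IsGreatest (holevoRates (QShannon.tensorPow Φ n)) (n * classicalRate W q) := by
  rw [← classicalRate_powDist_prod h.mem_simplex n hq]
  exact (h.tensorPow n).isGreatest_holevoRates (prod_mem_stdSimplex hq n)
    (isMaxOn_classicalRate_powDist h.mem_simplex n hq hmax)

/-- The classical capacity of a classical channel is Shannon's. -/
theorem IsClassicalForm.tendsto_nShotCapacity (h : IsClassicalForm Φ U V W) {q : A → ℝ}
    (hq : q ∈ stdSimplex ℝ A) (hmax : IsMaxOn (classicalRate W) (stdSimplex ℝ A) q) :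
    Tendsto (nShotCapacity Φ) atTop (𝓝 (classicalRate W q)) := by
  -- The sequence is constant for `n > 0`; only `n = 0`, a division by zero, is discarded.
  refine tendsto_const_nhds.congr' ?_
  filter_upwards [eventually_gt_atTop 0] with n hn
  rw [nShotCapacity, oneShotCapacity, (h.isGreatest_tensorPow hq hmax n).csSup_eq,
    mul_div_cancel_left₀ _ (by exact_mod_cast hn.ne')]

end Classical

/-! ### Conditioning on the classical input, and additivity -/

section Additivity

variable {A B A' B' E κ κ' : Type*} [Fintype A] [DecidableEq A] [Fintype B] [DecidableEq B]
  [Fintype A'] [DecidableEq A'] [Fintype B'] [DecidableEq B'] [Fintype E] [DecidableEq E]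
  [Fintype κ] [DecidableEq κ] [Fintype κ'] [DecidableEq κ']

theorem traceLeft_tensorMap {Φ : Matrix A A ℂ →ₗ[ℂ] Matrix B B ℂ}
    {Ψ : Matrix A' A' ℂ →ₗ[ℂ] Matrix B' B' ℂ} (hΦ : ∀ X, (Φ X).trace = X.trace)
    (X : Matrix (A × A') (A × A') ℂ) : traceLeft (tensorMap Φ Ψ X) = Ψ (traceLeft X) := by
  have h : traceLeft ∘ₗ tensorMap Φ Ψ = Ψ ∘ₗ traceLeft := linearMap_ext_kronecker fun X Y => by
    simp only [LinearMap.comp_apply, tensorMap_kronecker, traceLeft_kronecker, hΦ, map_smul]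
  exact LinearMap.congr_fun h X

theorem traceRight_kronecker (ρ : Matrix A A ℂ) (σ : Matrix E E ℂ) :
    traceRight (ρ ⊗ₖ σ) = σ.trace • ρ := by
  ext e e'
  simp [traceRight_apply, Matrix.trace, Finset.mul_sum, mul_comm]

theorem traceRight_tensorMap {Φ : Matrix A A ℂ →ₗ[ℂ] Matrix B B ℂ}
    {Ψ : Matrix A' A' ℂ →ₗ[ℂ] Matrix B' B' ℂ} (hΨ : ∀ X, (Ψ X).trace = X.trace)
    (X : Matrix (A × A') (A × A') ℂ) : traceRight (tensorMap Φ Ψ X) = Φ (traceRight X) := by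
  have h : traceRight ∘ₗ tensorMap Φ Ψ = Φ ∘ₗ traceRight := linearMap_ext_kronecker fun X Y => by
    simp only [LinearMap.comp_apply, tensorMap_kronecker, traceRight_kronecker, hΨ, map_smul]
  exact LinearMap.congr_fun h X

theorem isState_traceLeft {ρ : Matrix (A × E) (A × E) ℂ} (h : IsState ρ) :
    IsState (traceLeft ρ) := ⟨posSemidef_traceLeft h.1, (trace_traceLeft ρ).trans h.2⟩

theorem isState_traceRight {ρ : Matrix (A × E) (A × E) ℂ} (h : IsState ρ) :
    IsState (traceRight ρ) := ⟨posSemidef_traceRight h.1, (trace_traceRight ρ).trans h.2⟩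

theorem entropy_unit {M : Matrix Unit Unit ℂ} (hM : M.IsHermitian) :
    entropy M = eta M.trace.re := by
  rw [entropy_eq_sum_eigenvalues hM, hM.trace_eq_sum_eigenvalues]
  simp

/-- Concavity of the entropy, on the cone of positive semidefinite matrices. -/
theorem sum_entropy_sub_le {ι : Type*} [Fintype ι] [Nonempty ι] [Nonempty A]
    {ω : ι → Matrix A A ℂ} (hω : ∀ i, (ω i).PosSemidef) :
    ∑ i, (entropy (ω i) - eta (ω i).trace.re) ≤
      entropy (∑ i, ω i) - eta (∑ i, ω i).trace.re := by
  -- Concavity is strong subadditivity with a one-dimensional `E`: the partial trace becomes the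
  -- trace.
  have h1 : ∀ M : Matrix A A ℂ, M.IsHermitian →
      entropy (M ⊗ₖ (1 : Matrix Unit Unit ℂ)) = entropy M ∧
      entropy (traceLeft (M ⊗ₖ (1 : Matrix Unit Unit ℂ))) = eta M.trace.re := by
    intro M hM
    have hM1 : (M ⊗ₖ (1 : Matrix Unit Unit ℂ)).IsHermitian := by
      rw [Matrix.IsHermitian, Matrix.conjTranspose_kronecker, hM.eq, Matrix.conjTranspose_one]
    constructor
    · rw [entropy_kronecker hM Matrix.isHermitian_one, entropy_unit Matrix.isHermitian_one]
      simp
    · rw [entropy_unit (isHermitian_traceLeft hM1), trace_traceLeft, Matrix.trace_kronecker]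
      simp
  have hsum : ∑ i, ω i ⊗ₖ (1 : Matrix Unit Unit ℂ) = (∑ i, ω i) ⊗ₖ (1 : Matrix Unit Unit ℂ) := by
    ext x y
    simp only [Matrix.sum_apply, Matrix.kroneckerMap_apply, Finset.sum_mul]
  have h := sum_condEntropy_le (ω := fun i => ω i ⊗ₖ (1 : Matrix Unit Unit ℂ))
    fun i => (hω i).kronecker Matrix.PosSemidef.one
  have hS : (∑ i, ω i).PosSemidef := Matrix.posSemidef_sum _ fun i _ => hω i
  rw [hsum, (h1 _ hS.isHermitian).1, (h1 _ hS.isHermitian).2] at h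
  simpa only [(h1 _ (hω _).isHermitian).1, (h1 _ (hω _).isHermitian).2] using h

theorem trace_complement {Φ : Matrix A A ℂ →ₗ[ℂ] Matrix B B ℂ} {K : κ → Matrix B A ℂ}
    (h : HasKraus Φ K) (X : Matrix A A ℂ) : (complement K X).trace = X.trace := by
  rw [← h.trace_map X, h.1, Matrix.trace_sum]
  rfl

/-- The terms `eta c · tr ρ` cancel since the complementary channel preserves the trace; this makes
the gain usable on unnormalized states. -/
theorem entropyGain_smul {Φ : Matrix A A ℂ →ₗ[ℂ] Matrix B B ℂ} {K : κ → Matrix B A ℂ}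
    (h : HasKraus Φ K) {ρ : Matrix A A ℂ} (hρ : ρ.IsHermitian) (c : ℝ) :
    entropyGain K ((c : ℂ) • ρ) = c * entropyGain K ρ := by
  rw [entropyGain, entropyGain, map_smul, entropy_smul hρ,
    entropy_smul (isHermitian_complement K hρ), trace_complement h]
  ring

theorem complement_kronecker (K : κ → Matrix B A ℂ) (L : κ' → Matrix B' A' ℂ)
    (X : Matrix A A ℂ) (Y : Matrix A' A' ℂ) :
    complement (fun k : κ × κ' => K k.1 ⊗ₖ L k.2) (X ⊗ₖ Y) = complement K X ⊗ₖ complement L Y := by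
  ext k l
  simp only [complement, LinearMap.coe_mk, AddHom.coe_mk, Matrix.of_apply,
    Matrix.conjTranspose_kronecker, ← Matrix.mul_kronecker_mul, Matrix.trace_kronecker,
    Matrix.kroneckerMap_apply]

/-- For pure inputs the entropy exchange is the output entropy. -/
theorem entropy_complement_pureState {Φ : Matrix A A ℂ →ₗ[ℂ] Matrix B B ℂ}
    {K : κ → Matrix B A ℂ} (h : HasKraus Φ K) (φ : A → ℂ) :
    entropy (complement K (pureState φ)) = entropy (Φ (pureState φ)) := by
  have hφ : IsPurification (fun x : A × Unit => φ x.1) (pureState φ) := fun a a' => by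
    simp [pureState, Matrix.vecMulVec_apply]
  have hP : (pureState φ).IsHermitian := (Matrix.posSemidef_vecMulVec_self_star φ).isHermitian
  rw [← entropy_exchange h hφ, ← entropy_reindex (Equiv.prodUnique B Unit).symm _
    (h.isHermitian_map hP)]
  congr 1
  ext ⟨b, e⟩ ⟨b', e'⟩
  rw [tensorMap_id_apply]
  rfl

/-- The operator `⟨u| Z |u⟩` obtained by applying a vector functional to the first factor. -/
def condMap (u : A → ℂ) : Matrix (A × A') (A × A') ℂ →ₗ[ℂ] Matrix A' A' ℂ where
  toFun Z := Matrix.of fun c c' => ∑ a, ∑ a', star (u a) * Z (a, c) (a', c') * u a'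
  map_add' Y Z := by
    ext; simp [mul_add, add_mul, Finset.sum_add_distrib]
  map_smul' r Z := by
    ext
    simp only [Matrix.smul_apply, Matrix.of_apply, smul_eq_mul, Finset.mul_sum, RingHom.id_apply]
    exact Finset.sum_congr rfl fun a _ => Finset.sum_congr rfl fun a' _ => by ring

theorem condMap_apply (u : A → ℂ) (Z : Matrix (A × A') (A × A') ℂ) (c c' : A') :
    condMap u Z c c' = ∑ a, ∑ a', star (u a) * Z (a, c) (a', c') * u a' := rfl

theorem conj_apply_diag (U X : Matrix A A ℂ) (x : A) :
    (Uᴴ * X * U) x x = ∑ a, ∑ a', star (U a x) * X a a' * U a' x := by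
  rw [Matrix.mul_apply, Finset.sum_comm]
  refine Finset.sum_congr rfl fun a' _ => ?_
  rw [Matrix.mul_apply, Finset.sum_mul]
  rfl

theorem condMap_kronecker (U : Matrix A A ℂ) (x : A) (X : Matrix A A ℂ) (Y : Matrix A' A' ℂ) :
    condMap (fun a => U a x) (X ⊗ₖ Y) = (Uᴴ * X * U) x x • Y := by
  ext c c'
  rw [condMap_apply, Matrix.smul_apply, conj_apply_diag, smul_eq_mul, Finset.sum_mul]
  refine Finset.sum_congr rfl fun a _ => ?_
  rw [Finset.sum_mul]
  exact Finset.sum_congr rfl fun a' _ => by rw [Matrix.kroneckerMap_apply]; ring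

theorem sum_condMap {U : Matrix A A ℂ} (hU : Uᴴ * U = 1) (Z : Matrix (A × A') (A × A') ℂ) :
    ∑ x, condMap (fun a => U a x) Z = traceLeft Z := by
  have h : ∑ x, condMap (A' := A') (fun a => U a x) = traceLeft :=
    linearMap_ext_kronecker fun X Y => by
      rw [LinearMap.sum_apply, traceLeft_kronecker]
      simp only [condMap_kronecker, ← Finset.sum_smul]
      congr 1
      change (Uᴴ * X * U).trace = X.trace
      rw [Matrix.trace_mul_cycle, mul_eq_one_comm.1 hU, Matrix.one_mul]
  rw [← h, LinearMap.sum_apply]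

theorem trace_condMap (U : Matrix A A ℂ) (x : A) (Z : Matrix (A × A') (A × A') ℂ) :
    (condMap (fun a => U a x) Z).trace = (Uᴴ * traceRight Z * U) x x := by
  rw [conj_apply_diag]
  simp only [Matrix.trace, Matrix.diag_apply, condMap_apply, traceRight_apply, Finset.mul_sum,
    Finset.sum_mul]
  rw [Finset.sum_comm]
  exact Finset.sum_congr rfl fun a _ => Finset.sum_comm

/-- The conditional vector `(⟨u| ⊗ 1) φ`. -/
def condVec (u : A → ℂ) (φ : (A × A') × E → ℂ) (y : A' × E) : ℂ :=
  ∑ a, star (u a) * φ ((a, y.1), y.2)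

theorem condVec_block (u : A → ℂ) (φ : (A × A') × E → ℂ) (e e' : E) :
    (pureState (condVec u φ)).submatrix (fun c => (c, e)) (fun c => (c, e')) =
      condMap u ((pureState φ).submatrix (fun c => (c, e)) (fun c => (c, e'))) := by
  ext c c'
  simp only [condMap_apply, Matrix.submatrix_apply, pureState, Matrix.vecMulVec_apply,
    Pi.star_apply, condVec, star_sum, star_mul', star_star, Finset.sum_mul_sum]
  exact Finset.sum_congr rfl fun a _ => Finset.sum_congr rfl fun a' _ => by ring

/-- The functional `⟨u|` touches only the measured factor and hence commutes with the partial trace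
over `E`. -/
theorem isPurification_condVec (u : A → ℂ) {φ : (A × A') × E → ℂ}
    {ρ : Matrix (A × A') (A × A') ℂ} (h : IsPurification φ ρ) :
    IsPurification (condVec u φ) (condMap u ρ) := by
  have hρ : ρ = ∑ e, (pureState φ).submatrix (fun c => (c, e)) (fun c => (c, e)) := by
    ext c c'
    rw [← h, Matrix.sum_apply]
    rfl
  intro c c'
  rw [hρ, map_sum, Matrix.sum_apply]
  exact Finset.sum_congr rfl fun e _ => by rw [← condVec_block]; rfl

theorem IsPurification.posSemidef {φ : A × E → ℂ} {ρ : Matrix A A ℂ} (h : IsPurification φ ρ) :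
    ρ.PosSemidef := by
  have hρ : ρ = traceRight (pureState φ) := by
    ext a a'
    rw [traceRight_apply, h]
  rw [hρ]
  exact posSemidef_traceRight (Matrix.posSemidef_vecMulVec_self_star φ)

variable {Φ : Matrix A A ℂ →ₗ[ℂ] Matrix B B ℂ} {U : Matrix A A ℂ} {V : Matrix B B ℂ}
  {W : A → B → ℝ} {Ψ : Matrix A' A' ℂ →ₗ[ℂ] Matrix B' B' ℂ} {L : κ' → Matrix B' A' ℂ}

/-- Classical channels have Kraus representations. -/
theorem IsClassicalForm.exists_hasKraus (h : IsClassicalForm Φ U V W) :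
    ∃ K : A × B → Matrix B A ℂ, HasKraus Φ K := by
  -- The Kraus operators are `√W(y|x) |f_y⟩⟨e_x|`.
  refine ⟨fun k => Matrix.of fun b a => (Real.sqrt (W k.1 k.2) : ℂ) * V b k.2 * star (U a k.1),
    fun X => ?_, ?_⟩
  · have hsq : ∀ x y, (W x y : ℂ) = (Real.sqrt (W x y) : ℂ) * (Real.sqrt (W x y) : ℂ) := by
      intro x y
      rw [← Complex.ofReal_mul, Real.mul_self_sqrt ((h.mem_simplex x).1 y)]
    rw [h.apply_eq]
    ext b b'
    rw [Matrix.mul_apply, Matrix.sum_apply, Fintype.sum_prod_type_right]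
    refine Finset.sum_congr rfl fun y _ => ?_
    rw [Matrix.mul_diagonal, Finset.mul_sum, Finset.sum_mul]
    refine Finset.sum_congr rfl fun x _ => ?_
    rw [conj_apply_diag, hsq]
    simp only [Matrix.mul_apply, Matrix.conjTranspose_apply, Matrix.of_apply, Finset.mul_sum,
      Finset.sum_mul, star_mul', Complex.star_def, Complex.conj_conj, Complex.conj_ofReal]
    rw [Finset.sum_comm]
    exact Finset.sum_congr rfl fun a _ => Finset.sum_congr rfl fun a' _ => by ring
  · have hV : ∀ y, ∑ b, star (V b y) * V b y = 1 := fun y => by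
      have := congrFun (congrFun h.star_mul_right y) y
      rwa [Matrix.one_apply_eq] at this
    have hsq : ∀ x y, (Real.sqrt (W x y) : ℂ) * (Real.sqrt (W x y) : ℂ) = (W x y : ℂ) := by
      intro x y
      rw [← Complex.ofReal_mul, Real.mul_self_sqrt ((h.mem_simplex x).1 y)]
    have hW : ∀ x, ∑ y, (W x y : ℂ) = 1 := fun x => by exact_mod_cast (h.mem_simplex x).2
    rw [← mul_eq_one_comm.1 h.star_mul_left]
    ext a a'
    rw [Matrix.sum_apply, Matrix.mul_apply, Fintype.sum_prod_type]
    refine Finset.sum_congr rfl fun x _ => ?_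
    have h1 : ∀ y, ((Matrix.of fun b a => (Real.sqrt (W x y) : ℂ) * V b y * star (U a x))ᴴ *
        (Matrix.of fun b a => (Real.sqrt (W x y) : ℂ) * V b y * star (U a x))) a a' =
        U a x * star (U a' x) * (W x y : ℂ) := by
      intro y
      rw [← hsq, ← mul_one (U a x * _ * _), ← hV y, Finset.mul_sum, Matrix.mul_apply]
      refine Finset.sum_congr rfl fun b _ => ?_
      simp only [Matrix.conjTranspose_apply, Matrix.of_apply, star_mul', Complex.conj_conj,
        Complex.star_def, Complex.conj_ofReal]
      ring
    simp only [h1]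
    rw [← Finset.mul_sum, hW, mul_one, Matrix.conjTranspose_apply]

theorem IsClassicalForm.apply_eq_sum (h : IsClassicalForm Φ U V W) (X : Matrix A A ℂ) :
    Φ X = ∑ x, (Uᴴ * X * U) x x • Φ (basisState U x) := by
  have hb : ∀ x, Φ (basisState U x) = V * Matrix.diagonal (fun y => (W x y : ℂ)) * Vᴴ := by
    intro x
    rw [h.apply_eq, conj_basisState h.star_mul_left]
    congr 3
    ext y
    simp [Matrix.single_apply]
  rw [h.apply_eq]
  ext b b'
  simp only [hb, Matrix.sum_apply, Matrix.smul_apply, Matrix.mul_apply (N := Vᴴ),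
    Matrix.mul_diagonal, smul_eq_mul, Finset.mul_sum, Finset.sum_mul]
  rw [Finset.sum_comm]
  exact Finset.sum_congr rfl fun x _ => Finset.sum_congr rfl fun y _ => by ring

/-- The linear map `Y ↦ M ⊗ Y`. -/
def kroneckerLeft (M : Matrix B B ℂ) : Matrix B' B' ℂ →ₗ[ℂ] Matrix (B × B') (B × B') ℂ where
  toFun Y := M ⊗ₖ Y
  map_add' _ _ := Matrix.kronecker_add _ _ _
  map_smul' _ _ := Matrix.kronecker_smul _ _ _

/-- Measure and prepare: outcome `x` prepares a fixed output of `Φ`, in a product with the image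
under `Ψ` of the unnormalized conditional operator. -/
theorem IsClassicalForm.tensorMap_eq (h : IsClassicalForm Φ U V W)
    (Z : Matrix (A × A') (A × A') ℂ) :
    tensorMap Φ Ψ Z = ∑ x, Φ (basisState U x) ⊗ₖ Ψ (condMap (fun a => U a x) Z) := by
  have hT : tensorMap Φ Ψ = ∑ x, kroneckerLeft (Φ (basisState U x)) ∘ₗ Ψ ∘ₗ
      condMap (fun a => U a x) := linearMap_ext_kronecker fun X Y => by
    rw [tensorMap_kronecker, h.apply_eq_sum X, LinearMap.sum_apply]
    ext i j
    simp only [LinearMap.comp_apply, condMap_kronecker, map_smul, Matrix.kroneckerMap_apply,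
      Matrix.sum_apply, Matrix.smul_apply, smul_eq_mul, Finset.sum_mul, kroneckerLeft,
      LinearMap.coe_mk, AddHom.coe_mk]
    exact Finset.sum_congr rfl fun x _ => by ring
  rw [hT, LinearMap.sum_apply]
  rfl

/-- The key entropy inequality: the entropy exchange of `Φ ⊗ Ψ` with `Φ` classical is controlled by
the states conditioned on the outcome of the measurement on the classical input. -/
theorem IsClassicalForm.entropyGain_le [Nonempty A] (h : IsClassicalForm Φ U V W)
    (hK : ∃ K : A × B → Matrix B A ℂ, HasKraus Φ K)
    (hL : HasKraus Ψ L) {φ : (A × A') × E → ℂ} {ρ : Matrix (A × A') (A × A') ℂ}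
    (hρ : IsState ρ) (hφ : IsPurification φ ρ) :
    entropy ρ - entropy (tensorMap (tensorMap Φ Ψ)
        (LinearMap.id : Matrix E E ℂ →ₗ[ℂ] _) (pureState φ)) ≤
      ∑ x, (entropyGain L (condMap (fun a => U a x) ρ) -
        (condMap (fun a => U a x) ρ).trace.re * shannon (W x)) := by
  obtain ⟨K, hK⟩ := hK
  have hKL := hK.tensorMap hL
  have : Nonempty (B × B') := (hKL.isState_map hρ).nonempty
  set S : A → Matrix B B ℂ := fun x => Φ (basisState U x) with hS
  set T : A → Matrix (B' × E) (B' × E) ℂ := fun x => tensorMap Ψ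
    (LinearMap.id : Matrix E E ℂ →ₗ[ℂ] _) (pureState (condVec (fun a => U a x) φ)) with hT
  have hSst : ∀ x, IsState (S x) := fun x => hK.isState_map (isState_basisState h.star_mul_left x)
  have hTpos : ∀ x, (T x).PosSemidef := fun x =>
    (hL.tensorMap hasKraus_id).posSemidef_map (Matrix.posSemidef_vecMulVec_self_star _)
  let e := Equiv.prodAssoc B B' E
  -- The unnormalized joint output given outcome `x`, bracketed so that `traceLeft` removes both
  -- channel outputs and leaves `E`.
  let ω : A → Matrix ((B × B') × E) ((B × B') × E) ℂ := fun x => (S x ⊗ₖ T x).submatrix e e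
  have hω : ∀ x, (ω x).PosSemidef := fun x => ((hSst x).1.kronecker (hTpos x)).submatrix _
  have hsum : ∑ x, ω x = tensorMap (tensorMap Φ Ψ) (LinearMap.id : Matrix E E ℂ →ₗ[ℂ] _)
      (pureState φ) := by
    ext ⟨⟨b, c⟩, i⟩ ⟨⟨b', c'⟩, i'⟩
    rw [tensorMap_id_apply, h.tensorMap_eq, Matrix.sum_apply, Matrix.sum_apply]
    refine Finset.sum_congr rfl fun x _ => ?_
    simp only [ω, Matrix.submatrix_apply, Matrix.kroneckerMap_apply, e, Equiv.prodAssoc_apply, hT,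
      tensorMap_id_apply, condVec_block, hS]
  have hpur := fun x => isPurification_condVec (fun a => U a x) hφ
  have hωS : ∀ x, entropy (ω x) = (condMap (fun a => U a x) ρ).trace.re * shannon (W x) +
      entropy (complement L (condMap (fun a => U a x) ρ)) := by
    intro x
    have h1 := entropy_reindex e.symm (S x ⊗ₖ T x)
      ((hSst x).1.kronecker (hTpos x)).isHermitian
    rw [Equiv.symm_symm] at h1
    have htr : (T x).trace = (condMap (fun a => U a x) ρ).trace := by
      rw [hT, (hL.tensorMap hasKraus_id).trace_map, ← trace_traceRight]
      congr 1
      ext c c'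
      rw [traceRight_apply, hpur x]
    rw [h1, entropy_kronecker (hSst x).1.isHermitian (hTpos x).isHermitian, htr, (hSst x).2, hS,
      h.entropy_basisState, hT, entropy_exchange hL (hpur x), Complex.one_re, one_mul]
  have hωE : ∀ x, entropy (traceLeft (ω x)) = entropy (condMap (fun a => U a x) ρ) := by
    intro x
    have h1 : traceLeft (ω x) = traceLeft (pureState (condVec (fun a => U a x) φ)) := by
      have h2 : traceLeft (ω x) = traceLeft (T x) := by
        ext i i'
        have h3 : ∑ b, S x b b = 1 := (hSst x).2
        simp only [traceLeft_apply, Fintype.sum_prod_type, ω, Matrix.submatrix_apply, e,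
          Equiv.prodAssoc_apply, Matrix.kroneckerMap_apply, ← Finset.mul_sum, ← Finset.sum_mul, h3,
          one_mul]
      rw [h2, hT, traceLeft_tensorMap hL.trace_map]
      rfl
    rw [h1, entropy_traceLeft_pureState (hpur x)]
  have hτE : entropy (traceLeft (∑ x, ω x)) = entropy ρ := by
    rw [hsum, traceLeft_tensorMap hKL.trace_map]
    exact entropy_traceLeft_pureState hφ
  -- Strong subadditivity for `∑ x, ω x`, conditioned on `E`. The `E` marginals have the entropies
  -- of the conditional inputs and of `ρ`, by purity of the vectors.
  have key := sum_condEntropy_le hω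
  rw [hτE, hsum] at key
  simp only [hωS, hωE] at key
  rw [← neg_le_neg_iff, ← Finset.sum_neg_distrib]
  refine le_trans (le_of_eq (Finset.sum_congr rfl fun x _ => ?_)) (key.trans_eq (by ring))
  rw [entropyGain]
  ring

theorem exists_isState_smul [Nonempty A] {σ : Matrix A A ℂ} (hσ : σ.PosSemidef) :
    ∃ τ, IsState τ ∧ σ = (σ.trace.re : ℂ) • τ := by
  have htr : (σ.trace.re : ℂ) = σ.trace := (Complex.eq_re_of_ofReal_le hσ.trace_nonneg).symm
  have h0 : 0 ≤ σ.trace.re := (Complex.le_def.1 hσ.trace_nonneg).1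
  -- An outcome of probability zero has no conditional state; any state serves, with weight 0.
  by_cases h : σ.trace = 0
  · obtain ⟨a⟩ := ‹Nonempty A›
    refine ⟨_, isState_pureState (φ := Pi.single a 1) (by simp), ?_⟩
    rw [hσ.trace_eq_zero_iff.1 h]
    simp
  · refine ⟨((σ.trace.re⁻¹ : ℝ) : ℂ) • σ, ⟨hσ.smul (by exact_mod_cast inv_nonneg.2 h0), ?_⟩, ?_⟩
    · rw [Matrix.trace_smul, Complex.ofReal_inv, htr, smul_eq_mul, inv_mul_cancel₀ h]
    · rw [smul_smul, Complex.ofReal_inv, htr, mul_inv_cancel₀ h, one_smul]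

/-- The converse: measuring the classical input turns any ensemble for the product channel into an
admissible ensemble for `Ψ` and an input distribution for `W`, whose rates together dominate. -/
theorem IsClassicalForm.le_of_mem_assistedRates [Nonempty A] [Nonempty A']
    (h : IsClassicalForm Φ U V W) (hL : HasKraus Ψ L) {q : A → ℝ}
    (hmax : IsMaxOn (classicalRate W) (stdSimplex ℝ A) q) {P R r : ℝ}
    (hR : R ∈ upperBounds (assistedRates Ψ P)) (hr : r ∈ assistedRates (tensorMap Φ Ψ) P) :
    r ≤ classicalRate W q + R := by
  obtain ⟨m, p, ρ, d, φ, ⟨hp, hp1, hρ⟩, hφ, hP, rfl⟩ := hr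
  obtain ⟨K, hK⟩ := h.exists_hasKraus
  have hKL := hK.tensorMap hL
  set σ : Fin m → A → Matrix A' A' ℂ := fun i x => condMap (fun a => U a x) (ρ i) with hσ
  have hpos : ∀ i x, (σ i x).PosSemidef := fun i x =>
    (isPurification_condVec (fun a => U a x) (hφ i)).posSemidef
  choose τ hτ hστ using fun i x => exists_isState_smul (hpos i x)
  set w : Fin m → A → ℝ := fun i => measureDist U (traceRight (ρ i)) with hw
  have hwtr : ∀ i x, (σ i x).trace.re = w i x := fun i x => by
    rw [hσ, trace_condMap]; rfl
  simp only [hwtr] at hστ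
  have hwmem : ∀ i, w i ∈ stdSimplex ℝ A := fun i =>
    measureDist_mem h.star_mul_left (isState_traceRight (hρ i))
  have hσsum : ∀ i, ∑ x, σ i x = traceLeft (ρ i) := fun i => sum_condMap h.star_mul_left (ρ i)
  have hgain : ∀ i, entropy (ρ i) - entropy (tensorMap (tensorMap Φ Ψ)
      (LinearMap.id : Matrix (Fin d) (Fin d) ℂ →ₗ[ℂ] _) (pureState (φ i))) ≤
      ∑ x, w i x * (entropyGain L (τ i x) - shannon (W x)) := by
    intro i
    refine (h.entropyGain_le ⟨K, hK⟩ hL (hρ i) (hφ i)).trans_eq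
      (Finset.sum_congr rfl fun x _ => ?_)
    change entropyGain L (σ i x) - (σ i x).trace.re * _ = _
    rw [hwtr, mul_sub]
    congr 1
    conv_lhs => rw [hστ i x]
    exact entropyGain_smul hL (hτ i x).1.isHermitian _
  -- The conditional states have the entropies of the `E` marginals `η x` of their purifying
  -- vectors. Those add up to the `E` marginal of `φ i`, of entropy `S(ρ i)`, and concavity applies.
  -- Hence the entanglement budget is respected.
  have hent : ∀ i, ∑ x, w i x * entropy (τ i x) ≤ entropy (ρ i) := by
    intro i
    have : Nonempty (Fin d) := by
      by_contra hd
      rw [not_nonempty_iff] at hd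
      have h1 : ρ i = 0 := by
        ext a a'
        rw [← hφ i]
        simp
      simpa [h1] using (hρ i).2
    set η : A → Matrix (Fin d) (Fin d) ℂ := fun x =>
      traceLeft (pureState (condVec (fun a => U a x) (φ i))) with hη
    have hηpos : ∀ x, (η x).PosSemidef := fun x =>
      posSemidef_traceLeft (Matrix.posSemidef_vecMulVec_self_star _)
    have hηtr : ∀ x, (η x).trace.re = w i x := by
      intro x
      rw [← hwtr, hη, trace_traceLeft, ← trace_traceRight]
      congr 2
      ext c c'
      rw [traceRight_apply, isPurification_condVec (fun a => U a x) (hφ i)]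
    have hηent : ∀ x, entropy (η x) = w i x * entropy (τ i x) + eta (w i x) := by
      intro x
      rw [hη, entropy_traceLeft_pureState (isPurification_condVec (fun a => U a x) (hφ i))]
      change entropy (σ i x) = _
      conv_lhs => rw [hστ i x]
      rw [entropy_smul (hτ i x).1.isHermitian, (hτ i x).2]
      simp
    -- The entries of `η x` are traces of conditioned blocks, so completeness of the basis `U` can
    -- be used block by block.
    have hηsum : ∑ x, η x = traceLeft (pureState (φ i)) := by
      ext j j'
      have h1 := congrArg Matrix.trace (sum_condMap h.star_mul_left
        ((pureState (φ i)).submatrix (fun c => (c, j)) (fun c => (c, j'))))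
      rw [trace_traceLeft, Matrix.trace_sum] at h1
      rw [Matrix.sum_apply, traceLeft_apply]
      refine Eq.trans (Finset.sum_congr rfl fun x _ => ?_) h1
      change traceLeft (pureState (condVec (fun a => U a x) (φ i))) j j' = _
      rw [traceLeft_apply, ← condVec_block]
      rfl
    have hc := sum_entropy_sub_le hηpos
    rw [hηsum, entropy_traceLeft_pureState (hφ i)] at hc
    have htr1 : (traceLeft (pureState (φ i))).trace.re = 1 := by
      rw [← hηsum, Matrix.trace_sum, Complex.re_sum]
      simp only [hηtr]
      exact (hwmem i).2
    rw [htr1, eta_one, sub_zero] at hc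
    simpa only [hηent, hηtr, add_sub_cancel_right] using hc
  have hmem := hL.mem_assistedRates (ι := Fin m × A) (P := P) (p := fun k => p k.1 * w k.1 k.2)
    (ρ := fun k => τ k.1 k.2) (fun k => mul_nonneg (hp _) ((hwmem _).1 _))
    (by rw [Fintype.sum_prod_type]; simp only [← Finset.mul_sum, (hwmem _).2, mul_one, hp1])
    (fun k => hτ _ _) (by
      rw [Fintype.sum_prod_type]
      simp only [mul_assoc, ← Finset.mul_sum]
      exact (Finset.sum_le_sum fun i _ => mul_le_mul_of_nonneg_left (hent i) (hp i)).trans hP)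
  have hle := hR hmem
  set ρbar := ∑ i, (p i : ℂ) • ρ i with hρbar
  have hst : IsState ρbar := isState_sum hp hp1 hρ
  have havg : ∑ k : Fin m × A, ((p k.1 * w k.1 k.2 : ℝ) : ℂ) • τ k.1 k.2 = traceLeft ρbar := by
    rw [Fintype.sum_prod_type, hρbar, map_sum]
    refine Finset.sum_congr rfl fun i _ => ?_
    rw [map_smul, ← hσsum, Finset.smul_sum]
    refine Finset.sum_congr rfl fun x _ => ?_
    rw [Complex.ofReal_mul, mul_smul, ← hστ i x]
  rw [havg, Fintype.sum_prod_type] at hle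
  set v := measureDist U (traceRight ρbar) with hv
  have hvmem : v ∈ stdSimplex ℝ A := measureDist_mem h.star_mul_left (isState_traceRight hst)
  have hvw : ∀ x, v x = ∑ i, p i * w i x := fun x => by
    rw [hv, hρbar, map_sum]
    simp only [map_smul]
    exact measureDist_sum p _ x
  -- Subadditivity of the entropy across the two outputs.
  have hout : entropy (tensorMap Φ Ψ ρbar) ≤
      shannon (outputDist W v) + entropy (Ψ (traceLeft ρbar)) := by
    have hst2 := hKL.isState_map hst
    have : Nonempty B := (isState_traceRight hst2).nonempty
    have : Nonempty B' := (isState_traceLeft hst2).nonempty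
    have := entropy_le_add hst2
    rwa [traceLeft_tensorMap hK.trace_map, traceRight_tensorMap hL.trace_map,
      h.entropy_apply (isState_traceRight hst).1] at this
  have hcl := hmax hvmem
  rw [Set.mem_ofPred_eq, classicalRate] at hcl
  -- The conditional entropy subtracted in `classicalRate W v` is exactly the average of the
  -- `H(W_x)` terms left over in `hgain`.
  have hvs : ∑ x, v x * shannon (W x) = ∑ i, p i * ∑ x, w i x * shannon (W x) := by
    simp only [hvw, Finset.sum_mul, Finset.mul_sum, mul_assoc]
    rw [Finset.sum_comm]
  have hG := Finset.sum_le_sum fun i (_ : i ∈ Finset.univ) =>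
    mul_le_mul_of_nonneg_left (hgain i) (hp i)
  simp only [mul_sub, Finset.sum_sub_distrib] at hG
  simp only [mul_assoc, ← Finset.mul_sum] at hle
  rw [hvs] at hcl
  linarith

/-- Achievability by the product ensemble of basis states and the given inputs: all entropies add,
and pure basis states leave the average input entropy unchanged. -/
theorem IsClassicalForm.add_mem_assistedRates (h : IsClassicalForm Φ U V W) (hL : HasKraus Ψ L)
    {q : A → ℝ} (hq : q ∈ stdSimplex ℝ A) {P r : ℝ} (hr : r ∈ assistedRates Ψ P) :
    classicalRate W q + r ∈ assistedRates (tensorMap Φ Ψ) P := by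
  obtain ⟨m, p, ρ, ⟨hp, hp1, hρ⟩, hP, rfl⟩ := hL.exists_ensemble hr
  obtain ⟨K, hK⟩ := h.exists_hasKraus
  have hU := h.star_mul_left
  have hb := fun x => isState_basisState hU x
  have hb0 : ∀ x, entropy (basisState U x) = 0 := fun x =>
    entropy_pureState (star_dotProduct_col hU x)
  have hS : ∀ x i, entropy (basisState U x ⊗ₖ ρ i) = entropy (ρ i) := fun x i => by
    rw [entropy_kronecker (hb x).1.isHermitian (hρ i).1.isHermitian, hb0, (hb x).2]
    simp
  have hgain : ∀ x i, entropyGain (fun k : (A × B) × κ' => K k.1 ⊗ₖ L k.2)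
      (basisState U x ⊗ₖ ρ i) = entropyGain L (ρ i) - shannon (W x) := fun x i => by
    -- A pure input makes output and environment jointly pure, so the environment carries the output
    -- entropy `H(W_x)`.
    have h1 : entropy (complement K (basisState U x)) = shannon (W x) := by
      rw [← h.entropy_basisState x]
      exact entropy_complement_pureState hK _
    rw [entropyGain, hS, complement_kronecker, entropy_kronecker
      (isHermitian_complement K (hb x).1.isHermitian)
      (isHermitian_complement L (hρ i).1.isHermitian), trace_complement hK, trace_complement hL,
      (hb x).2, (hρ i).2, h1, entropyGain, Complex.one_re]
    ring
  have hmem := (hK.tensorMap hL).mem_assistedRates (ι := A × Fin m) (P := P)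
    (p := fun k => q k.1 * p k.2) (ρ := fun k => basisState U k.1 ⊗ₖ ρ k.2)
    (fun k => mul_nonneg (hq.1 _) (hp _))
    (by rw [Fintype.sum_prod_type]; simp only [← Finset.mul_sum, hp1, mul_one, hq.2])
    (fun k => ⟨(hb _).1.kronecker (hρ _).1, by
      rw [Matrix.trace_kronecker, (hb _).2, (hρ _).2, one_mul]⟩)
    (by
      rw [Fintype.sum_prod_type]
      simp only [hS, mul_assoc, ← Finset.mul_sum]
      rw [← Finset.sum_mul, hq.2, one_mul]
      exact hP)
  have havg : ∑ k : A × Fin m, ((q k.1 * p k.2 : ℝ) : ℂ) • (basisState U k.1 ⊗ₖ ρ k.2) =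
      (∑ x, (q x : ℂ) • basisState U x) ⊗ₖ (∑ i, (p i : ℂ) • ρ i) := by
    ext a b
    simp only [Fintype.sum_prod_type, Matrix.sum_apply, Matrix.smul_apply,
      Matrix.kroneckerMap_apply, Finset.sum_mul_sum, smul_eq_mul, Complex.ofReal_mul]
    exact Finset.sum_congr rfl fun x _ => Finset.sum_congr rfl fun i _ => by ring
  have hq' := hK.isState_map (isState_sum hq.1 hq.2 hb)
  have hp' := hL.isState_map (isState_sum hp hp1 hρ)
  rw [havg, tensorMap_kronecker, entropy_kronecker hq'.1.isHermitian hp'.1.isHermitian, hq'.2,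
    hp'.2, h.entropy_average hq, Fintype.sum_prod_type] at hmem
  convert hmem using 1
  have h1 : ∑ x, ∑ i, q x * p i * (entropyGain L (ρ i) - shannon (W x)) =
      ∑ i, p i * entropyGain L (ρ i) - ∑ x, q x * shannon (W x) := by
    have h2 : ∀ x, ∑ i, q x * p i * (entropyGain L (ρ i) - shannon (W x)) =
        q x * ∑ i, p i * entropyGain L (ρ i) - q x * shannon (W x) := fun x => by
      simp only [mul_sub, Finset.sum_sub_distrib, mul_assoc, ← Finset.mul_sum]
      rw [← Finset.sum_mul, hp1, one_mul]
    simp only [h2, Finset.sum_sub_distrib]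
    rw [← Finset.sum_mul, hq.2, one_mul]
  simp only [hgain, h1, classicalRate, Complex.one_re]
  ring

end Additivity

end QShannon

end

theorem mainTheorem5 {A₀ B₀ A₁ B₁ : Type*}
    [Fintype A₀] [DecidableEq A₀] [Nonempty A₀] [Fintype B₀] [DecidableEq B₀]
    [Fintype A₁] [DecidableEq A₁] [Nonempty A₁] [Fintype B₁] [DecidableEq B₁]
    (Ψ₀ : Matrix A₀ A₀ ℂ →ₗ[ℂ] Matrix B₀ B₀ ℂ) (hΨ₀ : QShannon.IsClassicalChannel Ψ₀)
    (Ψ₁ : Matrix A₁ A₁ ℂ →ₗ[ℂ] Matrix B₁ B₁ ℂ) (hΨ₁ : QShannon.IsChannel Ψ₁)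
    (P : ℝ) (hP : 0 ≤ P) :
    -- the maxima and the limit in the definitions of the three capacities exist
    (∀ n : ℕ, IsGreatest (QShannon.holevoRates (QShannon.tensorPow Ψ₀ n))
      (QShannon.oneShotCapacity (QShannon.tensorPow Ψ₀ n))) ∧
    Tendsto (QShannon.nShotCapacity Ψ₀) atTop (𝓝 (QShannon.capacity Ψ₀)) ∧
    IsGreatest (QShannon.assistedRates Ψ₁ P) (QShannon.assistedOneShotCapacity Ψ₁ P) ∧
    IsGreatest (QShannon.assistedRates (QShannon.tensorMap Ψ₀ Ψ₁) P)
      (QShannon.assistedOneShotCapacity (QShannon.tensorMap Ψ₀ Ψ₁) P) ∧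
    -- the additivity relation
    QShannon.assistedOneShotCapacity (QShannon.tensorMap Ψ₀ Ψ₁) P =
      QShannon.capacity Ψ₀ + QShannon.assistedOneShotCapacity Ψ₁ P := by
  obtain ⟨U, V, W, h⟩ := hΨ₀.exists_form
  obtain ⟨K, hK⟩ := h.exists_hasKraus
  obtain ⟨d, L, hL⟩ := hΨ₁.exists_hasKraus
  obtain ⟨q, hq, hmax⟩ := QShannon.exists_isMaxOn_classicalRate W
  have hlim := h.tendsto_nShotCapacity hq hmax
  have hcap : QShannon.capacity Ψ₀ = QShannon.classicalRate W q := hlim.limUnder_eq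
  have h1 := hL.isGreatest_assistedRates hP
  refine ⟨fun n => ?_, hcap ▸ hlim, h1, (hK.tensorMap hL).isGreatest_assistedRates hP, ?_⟩
  · have hn := h.isGreatest_tensorPow hq hmax n
    rw [QShannon.oneShotCapacity, hn.csSup_eq]
    exact hn
  · rw [hcap]
    exact IsGreatest.csSup_eq ⟨h.add_mem_assistedRates hL hq h1.1, fun r hr =>
      h.le_of_mem_assistedRates hL hmax h1.2 hr⟩
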